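/- Let $n \ge 0$ and let $X = \{[1:z_1:\cdots:z_n] \in \mathbb{C}P^n \mid z_i \neq 0,\ 1\le i\le n\} \cong (\mathbb{C}^*)^n$, equipped with the restriction of the Fubini–Study metric, normalized so that a projective line has area $1$. For a holomorphic map $f:\mathbb{C}\to X$ and $z = x+\sqrt{-1}\,y$, put $|df|(z) := \sqrt{2}\,|df(\partial/\partial z)|$, where $\partial/\partial z = \frac12(\partial/\partial x - \sqrt{-1}\,\partial/\partial y)$; equivalently, if $f = [1:f_1:\cdots:f_n]$, then $|df|^2 = \frac{1}{4\pi}\Delta\log\bigl(1+\sum_{i}|f_i|^2\bigr)$. Define the Shimizu–Ahlfors characteristic function and its order by $$T(r,f) := \int_1^r \frac{dt}{t}\int_{|z|\le t}|df|^2(z)\,dx\,dy \quad (r\ge 1), \qquad \rho_f := \limsup_{r\to\infty}\frac{\log T(r,f)}{\log r},$$ and the growth exponent of $|df|$ by $$\lambda_f := \limsup_{r\to\infty}\frac{\max_{|z|=r}\log|df|(z)}{\log r}.$$ Here $\log 0 = -\infty$ and $\rho_f,\lambda_f\in[-\infty,\infty]$. Then for every holomorphic map $f:\mathbb{C}\to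 X$ we have $$\rho_f < \infty \iff \lambda_f < \infty.$$ If moreover $\rho_f<\infty$ and $\lambda_f<\infty$ and $f$ is not a constant map, then $\rho_f$ and $\lambda_f$ are real numbers and $$\rho_f = \lambda_f + 1.$$ -/

import Mathlib

open Filter MeasureTheory

noncomputable section

namespace HolTorus

/-- Complex projective space `ℂPⁿ`, with homogeneous coordinates `[z₀ : z₁ : ⋯ : zₙ]`. -/
abbrev CP (n : ℕ) : Type := Projectivization ℂ (Fin (n + 1) → ℂ)

theorem cons_one_ne_zero {n : ℕ} (z : Fin n → ℂ) :
    (Fin.cons 1 z : Fin (n + 1) → ℂ) ≠ 0 := fun h => by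
  simpa using congrFun h 0

/-- The algebraic torus `X = {[1 : z₁ : ⋯ : zₙ] | zᵢ ≠ 0 for all i} ⊂ ℂPⁿ`. -/
def X (n : ℕ) : Set (CP n) :=
  {p | ∃ z : Fin n → ℂ, (∀ i, z i ≠ 0) ∧
    p = Projectivization.mk ℂ (Fin.cons 1 z) (cons_one_ne_zero z)}

/-- The affine coordinates `[z₀ : ⋯ : zₙ] ↦ (z₁ / z₀, …, zₙ / z₀)` of `ℂPⁿ` on `z₀ ≠ 0`.
They form a global holomorphic chart of the open submanifold `X`. -/
def affine {n : ℕ} (p : CP n) : EuclideanSpace ℂ (Fin n) :=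
  Projectivization.lift
    (fun v : {v : Fin (n + 1) → ℂ // v ≠ 0} =>
      (WithLp.toLp 2 (fun i : Fin n => v.1 i.succ / v.1 0) : EuclideanSpace ℂ (Fin n)))
    (by
      rintro ⟨a, ha⟩ ⟨b, hb⟩ t h
      have ht : t ≠ 0 := by
        rintro rfl
        exact ha (by simpa using h)
      ext i
      have h' : a = t • b := h
      subst h'
      simpa using mul_div_mul_left (b i.succ) (b 0) ht) p

theorem affine_mk {n : ℕ} (z : Fin n → ℂ) (i : Fin n) :
    affine (Projectivization.mk ℂ (Fin.cons 1 z) (cons_one_ne_zero z)) i = z i := by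
  simp [affine]

/-- The map `ℂ → ℂⁿ` that expresses `f : ℂ → X` in the affine coordinates of `X`. -/
def coords {n : ℕ} (f : ℂ → X n) (z : ℂ) : EuclideanSpace ℂ (Fin n) := affine (f z : CP n)

/-- `f : ℂ → X` is holomorphic: it is so in the global holomorphic chart of `X`. -/
def IsHolomorphic {n : ℕ} (f : ℂ → X n) : Prop := Differentiable ℂ (coords f)

/-- The Fubini–Study (Riemannian) metric of `ℂPⁿ`, in affine coordinates: its value on the real
tangent vectors `v, w ∈ ℂⁿ` at the point with affine coordinates `p ∈ ℂⁿ`, normalized so that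
a projective line has area one. -/
def fubiniStudy {n : ℕ} (p v w : EuclideanSpace ℂ (Fin n)) : ℝ :=
  (1 / Real.pi) *
    (((1 + ‖p‖ ^ 2 : ℝ) * inner ℂ v w - inner ℂ v p * inner ℂ p w : ℂ).re / (1 + ‖p‖ ^ 2) ^ 2)

/-- The norm `|df(∂/∂z)|` of `df(∂/∂z) = (df(∂/∂x) - i df(∂/∂y)) / 2` for the Hermitian extension
of the Fubini–Study metric to the complexified tangent spaces: if `A`, `B` are real tangent
vectors, then `|(A - i B) / 2|² = (|A|² + |B|²) / 4`. -/
def normDz {n : ℕ} (f : ℂ → X n) (z : ℂ) : ℝ :=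
  let A := fderiv ℝ (coords f) z 1
  let B := fderiv ℝ (coords f) z Complex.I
  Real.sqrt ((fubiniStudy (coords f z) A A + fubiniStudy (coords f z) B B) / 4)

/-- The norm `|df|(z) = √2 |df(∂/∂z)|` of the differential. -/
def normDf {n : ℕ} (f : ℂ → X n) (z : ℂ) : ℝ := Real.sqrt 2 * normDz f z

/-- The Shimizu–Ahlfors characteristic `T(r, f) = ∫₁ʳ (dt / t) ∫_{|z| ≤ t} |df|² dx dy`. -/
def characteristic {n : ℕ} (f : ℂ → X n) (r : ℝ) : ℝ :=
  ∫ t in (1 : ℝ)..r, (1 / t) * ∫ z in Metric.closedBall (0 : ℂ) t, normDf f z ^ 2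

/-- The logarithm of a non-negative real number, with `log 0 = -∞`. -/
def elog (x : ℝ) : EReal := ENNReal.log (ENNReal.ofReal x)

/-- The order `ρ_f = limsup_{r → ∞} log T(r, f) / log r`, an extended real number. -/
def order {n : ℕ} (f : ℂ → X n) : EReal :=
  limsup (fun r : ℝ => elog (characteristic f r) / (Real.log r : EReal)) atTop

/-- The growth exponent `limsup_{r → ∞} (max_{|z| = r} log |df|(z)) / log r` of `|df|`, an
extended real number. -/
def growthExponent {n : ℕ} (f : ℂ → X n) : EReal :=
  limsup (fun r : ℝ =>
    (⨆ z ∈ Metric.sphere (0 : ℂ) r, elog (normDf f z)) / (Real.log r : EReal)) atTop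

end HolTorus

end

open Filter MeasureTheory

noncomputable section

namespace HolTorus

/-! ### Extended logarithms and growth rates -/

/-! The affine coordinates of `f` have no zeros, so they are exponentials `exp (g i)` with `g i`
entire. Green's formula and an integration over the radius turn `T(r, f)` into `1 / (4π)` times the
integral of `log (1 + ‖F‖²)` over the circle of radius `r`, minus its value at radius 1
(`characteristic_eq`). Since `1 + ‖F‖²` is a sum of `n + 1` exponentials, its logarithm is at least
`2 max (Re g i, 0)` for each `i`, and exceeds the largest of these numbers by at most `log (n + 1)`.

If `λ < ∞`, then `|df|` grows polynomially, and integration gives `ρ < ∞`. If `ρ < ∞`, the mean of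
`|Re g i|` grows polynomially; it controls the Taylor coefficients (`norm_taylorCoeff_mul_pow_le`),
so every `g i` is a polynomial.

Let `k` be the largest degree of these polynomials, with `k ≥ 1` when `f` is not constant. The two
estimates of `log (1 + ‖F‖²)` give `ρ = k`. The bound `|df|² ≤ ∑ |g i'|²` (`density_le`) gives `λ ≤
k - 1`. For the converse, every large circle carries a point where two of `0, g 1, …, g n` with
different coefficients in degree `k` tie for the largest real part (`eventually_exists_re_eval_eq`).
There two homogeneous coordinates are equally dominant, no cancellation is possible, and `|df|` is
at least a multiple of `|g i' - g j'|`, which has order `r ^ (k - 1)` (`le_density`). -/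

theorem elog_of_pos {x : ℝ} (hx : 0 < x) : elog x = (Real.log x : EReal) :=
  ENNReal.log_ofReal_of_pos hx

theorem elog_mono {x y : ℝ} (h : x ≤ y) : elog x ≤ elog y :=
  ENNReal.log_monotone (ENNReal.ofReal_le_ofReal h)

theorem le_of_elog_le_elog {x y : ℝ} (hy : 0 ≤ y) (h : elog x ≤ elog y) : x ≤ y := by
  have := ENNReal.log_le_log_iff.1 h
  exact (ENNReal.ofReal_le_ofReal_iff hy).1 this

theorem tendsto_log_const_mul_rpow_div_log {C : ℝ} (hC : 0 < C) (a : ℝ) :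
    Tendsto (fun r : ℝ => elog (C * r ^ a) / (Real.log r : EReal)) atTop (nhds (a : EReal)) := by
  have h : Tendsto (fun r : ℝ => Real.log C / Real.log r + a) atTop (nhds (0 + a)) :=
    (Real.tendsto_log_atTop.const_div_atTop _).add_const a
  rw [zero_add] at h
  refine ((continuous_coe_real_ereal.tendsto a).comp h).congr' ?_
  filter_upwards [eventually_gt_atTop 1] with r hr
  have hr0 : 0 < r := by linarith
  have hl : Real.log r ≠ 0 := (Real.log_pos hr).ne'
  rw [elog_of_pos (by positivity), ← EReal.coe_div, Function.comp_apply, EReal.coe_eq_coe_iff,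
    Real.log_mul hC.ne' (by positivity), Real.log_rpow hr0]
  field_simp

theorem div_log_mono {x y : EReal} {r : ℝ} (hr : 1 < r) (h : x ≤ y) :
    x / (Real.log r : EReal) ≤ y / (Real.log r : EReal) :=
  EReal.div_le_div_right_of_nonneg (by exact_mod_cast (Real.log_pos hr).le) h

theorem limsup_div_log_le {φ : ℝ → EReal} {C a : ℝ} (hC : 0 < C)
    (h : ∀ᶠ r in atTop, φ r ≤ elog (C * r ^ a)) :
    limsup (fun r : ℝ => φ r / (Real.log r : EReal)) atTop ≤ (a : EReal) := by
  rw [← (tendsto_log_const_mul_rpow_div_log hC a).limsup_eq]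
  refine limsup_le_limsup ?_
  filter_upwards [h, eventually_gt_atTop 1] with r hr h1 using div_log_mono h1 hr

theorem le_limsup_div_log {φ : ℝ → EReal} {C a : ℝ} (hC : 0 < C)
    (h : ∀ᶠ r in atTop, elog (C * r ^ a) ≤ φ r) :
    (a : EReal) ≤ limsup (fun r : ℝ => φ r / (Real.log r : EReal)) atTop := by
  rw [← (tendsto_log_const_mul_rpow_div_log hC a).limsup_eq]
  refine limsup_le_limsup ?_
  filter_upwards [h, eventually_gt_atTop 1] with r hr h1 using div_log_mono h1 hr

/-- Finiteness of either exponent enters the proof only as this polynomial bound. -/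
theorem eventually_le_elog_pow {φ : ℝ → EReal}
    (h : limsup (fun r : ℝ => φ r / (Real.log r : EReal)) atTop < ⊤) :
    ∃ N : ℕ, ∀ᶠ r in atTop, φ r ≤ elog (r ^ N) := by
  obtain ⟨b, hb, -⟩ := EReal.exists_between_coe_real h
  obtain ⟨N, hN⟩ := exists_nat_ge b
  refine ⟨N, ?_⟩
  filter_upwards [eventually_lt_of_limsup_lt hb, eventually_gt_atTop 1] with r hr h1
  have hl := Real.log_pos h1
  rw [elog_of_pos (by positivity), Real.log_pow]
  have := (EReal.div_le_iff_le_mul (by exact_mod_cast hl) (EReal.coe_ne_top _)).1 hr.le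
  refine this.trans ?_
  rw [← EReal.coe_mul, EReal.coe_le_coe_iff, mul_comm]
  gcongr


/-! ### Green's formula in a disk -/

/-- Polar coordinates on a disk. -/
theorem setIntegral_closedBall_eq_polar {E : Type*} [NormedAddCommGroup E] [NormedSpace ℝ E]
    {f : ℂ → E} (hf : Continuous f) {t : ℝ} (ht : 0 ≤ t) :
    ∫ z in Metric.closedBall (0 : ℂ) t, f z =
      ∫ s in (0 : ℝ)..t, ∫ θ in (-Real.pi)..Real.pi, s • f (circleMap 0 s θ) := by
  have hpi : -Real.pi ≤ Real.pi := by linarith [Real.pi_pos]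
  rw [← integral_indicator Metric.isClosed_closedBall.measurableSet,
    ← Complex.integral_comp_polarCoord_symm]
  have h1 : ∀ p ∈ polarCoord.target, p.1 • (Metric.closedBall (0 : ℂ) t).indicator f
      (Complex.polarCoord.symm p) = (Set.Iic t ×ˢ Set.univ : Set (ℝ × ℝ)).indicator
        (fun p => p.1 • f (circleMap 0 p.1 p.2)) p := by
    rintro ⟨s, θ⟩ hp
    have hs : 0 < s := hp.1
    have e : Complex.polarCoord.symm (s, θ) = circleMap 0 s θ := by
      simp [circleMap, Complex.exp_mul_I]
    rw [e]
    by_cases h : s ≤ t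
    · rw [Set.indicator_of_mem (by simpa [abs_of_pos hs] using h),
        Set.indicator_of_mem (by simpa using h)]
    · rw [Set.indicator_of_notMem (by simpa [abs_of_pos hs] using h),
        Set.indicator_of_notMem (by simpa using h), smul_zero]
  rw [setIntegral_congr_fun polarCoord.open_target.measurableSet h1,
    setIntegral_indicator (measurableSet_Iic.prod MeasurableSet.univ)]
  have h2 : polarCoord.target ∩ Set.Iic t ×ˢ Set.univ = Set.Ioc 0 t ×ˢ Set.Ioo (-Real.pi) Real.pi := by
    rw [polarCoord_target, Set.prod_inter_prod, Set.inter_univ, Set.Ioi_inter_Iic]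
  have hc : Continuous fun p : ℝ × ℝ => p.1 • f (circleMap 0 p.1 p.2) := by
    refine continuous_fst.smul (hf.comp ?_)
    simp only [circleMap]; fun_prop
  rw [h2, Measure.volume_eq_prod, setIntegral_prod, intervalIntegral.integral_of_le ht]
  · simp_rw [intervalIntegral.integral_of_le hpi, integral_Ioc_eq_integral_Ioo]
  · rw [← Measure.volume_eq_prod]
    exact (hc.continuousOn.integrableOn_compact
      (isCompact_Icc.prod isCompact_Icc)).mono_set
      (Set.prod_mono Set.Ioc_subset_Icc_self Set.Ioo_subset_Icc_self)

/-- Write `L w = α w + β w̄`. The right side is `2β`; in the frame `e`, `i e` the same combination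
is `2β ē`, and `e ē = 1`. This is the rotation of `∂̄` to the polar frame. -/
theorem add_I_mul_map_unit (L : ℂ →L[ℝ] ℂ) (e : ℂ) (he : ‖e‖ = 1) :
    e * (L e + Complex.I * L (Complex.I * e)) = L 1 + Complex.I * L Complex.I := by
  have key : ∀ w : ℂ, L w = w.re * L 1 + w.im * L Complex.I := fun w => by
    conv_lhs => rw [show w = w.re • (1 : ℂ) + w.im • Complex.I by simp [Complex.re_add_im]]
    rw [map_add, map_smul, map_smul]; simp
  have h1 : (e.re : ℂ) ^ 2 + (e.im : ℂ) ^ 2 = 1 := by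
    have := Complex.sq_norm e
    rw [he, Complex.normSq_apply] at this
    exact_mod_cast (by nlinarith : e.re ^ 2 + e.im ^ 2 = 1)
  rw [key e, key (Complex.I * e)]
  conv_lhs => enter [1]; rw [← Complex.re_add_im e]
  simp only [Complex.mul_re, Complex.mul_im, Complex.I_re, Complex.I_im]
  push_cast
  linear_combination (L 1 + Complex.I * L Complex.I) * h1 +
    ((e.re : ℂ) * e.im * L Complex.I - (e.im : ℂ) ^ 2 * L 1) * Complex.I_sq

/-- **Green's formula** for the `∂̄`-derivative of a function in a disk. -/
theorem integral_closedBall_dbar {Φ : ℂ → ℂ} (hΦ : ContDiff ℝ 1 Φ) {t : ℝ} (ht : 0 ≤ t) :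
    ∫ z in Metric.closedBall (0 : ℂ) t, (fderiv ℝ Φ z 1 + Complex.I * fderiv ℝ Φ z Complex.I) =
      ∫ θ in (-Real.pi)..Real.pi, Φ (circleMap 0 t θ) * circleMap 0 t θ := by
  have hd : Continuous (fderiv ℝ Φ) := hΦ.continuous_fderiv (by norm_num)
  rw [setIntegral_closedBall_eq_polar (by fun_prop) ht]
  set e : ℝ × ℝ → ℂ := fun p => Complex.exp (p.2 * Complex.I) with he
  have hce : ∀ p : ℝ × ℝ, circleMap 0 p.1 p.2 = p.1 * e p := fun p => by simp [circleMap, he]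
  have hne : ∀ p : ℝ × ℝ, ‖e p‖ = 1 := fun p => Complex.norm_exp_ofReal_mul_I _
  set e' : ℝ × ℝ → ℝ × ℝ →L[ℝ] ℂ := fun p =>
    (ContinuousLinearMap.snd ℝ ℝ ℝ).smulRight (Complex.I * e p) with he'
  have hde : ∀ p, HasFDerivAt e (e' p) p := fun p => by
    have h1 : HasDerivAt (fun θ : ℝ => Complex.exp (θ * Complex.I)) (Complex.I * e p) p.2 := by
      have := ((hasDerivAt_id p.2).ofReal_comp.mul_const Complex.I).cexp
      simpa [he, mul_comm] using this
    have := h1.hasFDerivAt.comp p (hasFDerivAt_snd (𝕜 := ℝ) (E := ℝ) (F := ℝ) (p := p))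
    refine this.congr_fderiv ?_
    ext <;> simp [he']
  have hdz : ∀ p : ℝ × ℝ, HasFDerivAt (fun p : ℝ × ℝ => (p.1 : ℂ) * e p)
      ((p.1 : ℂ) • e' p + (ContinuousLinearMap.fst ℝ ℝ ℝ).smulRight (e p)) p := fun p => by
    have h1 : HasFDerivAt (fun p : ℝ × ℝ => (p.1 : ℂ))
        (Complex.ofRealCLM.comp (ContinuousLinearMap.fst ℝ ℝ ℝ)) p :=
      Complex.ofRealCLM.hasFDerivAt.comp p hasFDerivAt_fst
    refine (h1.mul (hde p)).congr_fderiv ?_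
    ext <;> simp
  set K : ℝ × ℝ → ℂ := fun p => Φ (p.1 * e p) * e p with hK
  have hdK : ∀ p : ℝ × ℝ, HasFDerivAt K (Φ (p.1 * e p) • e' p + e p • ((fderiv ℝ Φ (p.1 * e p)).comp
      ((p.1 : ℂ) • e' p + (ContinuousLinearMap.fst ℝ ℝ ℝ).smulRight (e p)))) p := fun p => by
    have h1 := (hΦ.differentiable (by norm_num) (p.1 * e p)).hasFDerivAt.comp p (hdz p)
    exact h1.mul (hde p)
  set K' := fun p : ℝ × ℝ => Φ (p.1 * e p) • e' p + e p • ((fderiv ℝ Φ (p.1 * e p)).comp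
      ((p.1 : ℂ) • e' p + (ContinuousLinearMap.fst ℝ ℝ ℝ).smulRight (e p))) with hK'
  set f' : ℝ × ℝ → ℝ × ℝ →L[ℝ] ℂ := fun p =>
    (p.1 : ℂ) • K' p + K p • (Complex.ofRealCLM.comp (ContinuousLinearMap.fst ℝ ℝ ℝ))
  have hf' : ∀ p : ℝ × ℝ, HasFDerivAt (fun p : ℝ × ℝ => (p.1 : ℂ) * K p) (f' p) p := fun p => by
    have h1 : HasFDerivAt (fun p : ℝ × ℝ => (p.1 : ℂ))
        (Complex.ofRealCLM.comp (ContinuousLinearMap.fst ℝ ℝ ℝ)) p :=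
      Complex.ofRealCLM.hasFDerivAt.comp p hasFDerivAt_fst
    exact h1.mul (hdK p)
  have hg' : ∀ p : ℝ × ℝ, HasFDerivAt (fun p : ℝ × ℝ => Complex.I * K p) (Complex.I • K' p) p :=
    fun p => (hdK p).const_mul Complex.I
  -- In the `(s, θ)` plane the field `(s K, i K)` has as divergence the integrand in polar
  -- coordinates: differentiating the factor `s` yields `K`, which cancels the `i² K` from
  -- differentiating the factor `e` of `K`.
  have hdiv : ∀ p : ℝ × ℝ, f' p (1, 0) + (Complex.I • K' p) (0, 1) =
      p.1 • (fderiv ℝ Φ (circleMap 0 p.1 p.2) 1 +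
        Complex.I * fderiv ℝ Φ (circleMap 0 p.1 p.2) Complex.I) := fun p => by
    rw [hce, ← add_I_mul_map_unit _ (e p) (hne p)]
    have hs : fderiv ℝ Φ (p.1 * e p) (p.1 * (Complex.I * e p)) =
        p.1 * fderiv ℝ Φ (p.1 * e p) (Complex.I * e p) := by
      simpa only [Complex.real_smul] using
        map_smul (fderiv ℝ Φ (p.1 * e p)) p.1 (Complex.I * e p)
    simp only [f', hK', he', hK, add_apply, smul_apply,
      ContinuousLinearMap.comp_apply, ContinuousLinearMap.smulRight_apply,
      ContinuousLinearMap.coe_fst', ContinuousLinearMap.coe_snd', smul_eq_mul, one_smul, zero_smul,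
      mul_zero, add_zero, zero_add, Complex.ofRealCLM_apply, Complex.ofReal_one,
      Complex.real_smul, hs]
    linear_combination (Φ (p.1 * e p) * e p) * Complex.I_sq
  have hcK : Continuous K := continuous_iff_continuousAt.2 fun p => (hdK p).continuousAt
  have hcc : Continuous fun p : ℝ × ℝ => circleMap 0 p.1 p.2 := by
    simp only [circleMap]; fun_prop
  have main := integral2_divergence_prod_of_hasFDerivAt (fun p : ℝ × ℝ => (p.1 : ℂ) * K p)
    (fun p : ℝ × ℝ => Complex.I * K p) f' (fun p => Complex.I • K' p) 0 (-Real.pi) t Real.pi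
    (by fun_prop) (by fun_prop) (fun p _ => hf' p) (fun p _ => hg' p) (by
      simp_rw [hdiv]
      refine ContinuousOn.integrableOn_compact (isCompact_uIcc.prod isCompact_uIcc) ?_
      fun_prop)
  simp_rw [hdiv] at main
  rw [main]
  -- The sides `θ = ±π` cancel by periodicity and the side `s = 0` vanishes because of the factor
  -- `s`; only `s = t` remains.
  have hper : ∀ x : ℝ, K (x, Real.pi) = K (x, -Real.pi) := fun x => by
    simp [hK, he, Complex.exp_neg]
  simp only [hper, sub_self, zero_add, Complex.ofReal_zero, zero_mul,
    intervalIntegral.integral_zero, sub_zero]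
  refine intervalIntegral.integral_congr fun θ _ => ?_
  simp only [hK, hce (t, θ)]
  ring


/-! ### The energy density and Jensen's formula -/

section Density

variable {E : Type*} [NormedAddCommGroup E] [InnerProductSpace ℂ E]

/-- The `∂`-derivative of `log (1 + ‖F‖²)`. -/
def dlogNorm (F : ℂ → E) (z : ℂ) : ℂ :=
  inner ℂ (F z) (deriv F z) / (1 + inner ℂ (F z) (F z))

/-- The quantity `∂∂̄ log (1 + ‖F‖²)`. -/
def density (F : ℂ → E) (z : ℂ) : ℝ :=
  ((1 + ‖F z‖ ^ 2) * ‖deriv F z‖ ^ 2 - ‖inner ℂ (F z) (deriv F z)‖ ^ 2) / (1 + ‖F z‖ ^ 2) ^ 2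

theorem inner_self_eq_ofReal (x : E) : (inner ℂ x x : ℂ) = ((‖x‖ ^ 2 : ℝ) : ℂ) := by
  rw [inner_self_eq_norm_sq_to_K]; push_cast; rfl

theorem inner_mul_symm_eq_ofReal (x y : E) :
    (inner ℂ x y * inner ℂ y x : ℂ) = ((‖(inner ℂ x y : ℂ)‖ ^ 2 : ℝ) : ℂ) := by
  rw [← inner_conj_symm y x, Complex.mul_conj, Complex.normSq_eq_norm_sq]

theorem one_add_inner_self (x : E) : (1 + inner ℂ x x : ℂ) = ((1 + ‖x‖ ^ 2 : ℝ) : ℂ) := by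
  rw [inner_self_eq_ofReal]; push_cast; rfl

theorem one_add_inner_self_ne_zero (x : E) : (1 + inner ℂ x x : ℂ) ≠ 0 := by
  rw [one_add_inner_self]
  exact_mod_cast (by positivity : (1 + ‖x‖ ^ 2 : ℝ) ≠ 0)

theorem density_nonneg (F : ℂ → E) (z : ℂ) : 0 ≤ density F z := by
  refine div_nonneg (sub_nonneg.2 ?_) (by positivity)
  have h := norm_inner_le_norm (𝕜 := ℂ) (F z) (deriv F z)
  calc ‖inner ℂ (F z) (deriv F z)‖ ^ 2 ≤ (‖F z‖ * ‖deriv F z‖) ^ 2 := by gcongr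
    _ ≤ (1 + ‖F z‖ ^ 2) * ‖deriv F z‖ ^ 2 := by nlinarith [sq_nonneg ‖deriv F z‖]

variable {F : ℂ → E}

theorem fderiv_real_apply (hF : Differentiable ℂ F) (z v : ℂ) :
    fderiv ℝ F z v = v • deriv F z := by
  rw [((hF z).hasDerivAt.hasFDerivAt.restrictScalars ℝ).fderiv]
  simp

theorem hasDerivAt_log_norm (hF : Differentiable ℂ F) (t θ : ℝ) :
    HasDerivAt (fun s : ℝ => Real.log (1 + ‖F (circleMap 0 s θ)‖ ^ 2))
      (2 * (dlogNorm F (circleMap 0 t θ) * Complex.exp (θ * Complex.I)).re) t := by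
  have h1 : HasDerivAt (fun s : ℝ => circleMap 0 s θ) (Complex.exp (θ * Complex.I)) t := by
    have := (Complex.ofRealCLM.hasDerivAt (x := t)).mul_const (Complex.exp (θ * Complex.I))
    simpa [circleMap] using this
  have h2 : HasDerivAt (fun s : ℝ => F (circleMap 0 s θ))
      (Complex.exp (θ * Complex.I) • deriv F (circleMap 0 t θ)) t :=
    HasDerivAt.scomp t (hF _).hasDerivAt h1
  have h3 := Complex.reCLM.hasFDerivAt.comp_hasDerivAt t (h2.inner ℂ h2)
  have h4 := h3.congr_of_eventuallyEq (f₁ := fun s : ℝ => ‖F (circleMap 0 s θ)‖ ^ 2)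
    (Eventually.of_forall fun s => norm_sq_eq_re_inner (𝕜 := ℂ) _)
  refine ((h4.const_add 1).log (by positivity)).congr_deriv ?_
  rw [← inner_conj_symm (Complex.exp (θ * Complex.I) • deriv F (circleMap 0 t θ)), Complex.reCLM_apply,
    Complex.add_re, Complex.conj_re, inner_smul_right, dlogNorm, one_add_inner_self,
    div_mul_eq_mul_div, Complex.div_ofReal_re, mul_div_assoc', mul_comm (inner ℂ _ _), two_mul]

variable [CompleteSpace E] (hF : Differentiable ℂ F)
include hF

theorem differentiable_deriv : Differentiable ℂ (deriv F) :=
  fun z => ((hF.analyticAt z).deriv).differentiableAt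

theorem contDiff_real {k : WithTop ℕ∞} : ContDiff ℝ k F := hF.contDiff.restrict_scalars ℝ

theorem contDiff_dlogNorm : ContDiff ℝ 1 (dlogNorm F) := by
  have h1 : ContDiff ℝ 1 F := contDiff_real hF
  have h2 : ContDiff ℝ 1 (deriv F) := contDiff_real (differentiable_deriv hF)
  have h3 : ContDiff ℝ 1 fun z => 1 + inner ℂ (F z) (F z) := contDiff_const.add (h1.inner ℂ h1)
  have h4 := (h1.inner ℂ h2).mul (h3.inv fun z => one_add_inner_self_ne_zero (F z))
  exact h4

theorem dbar_dlogNorm (z : ℂ) :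
    fderiv ℝ (dlogNorm F) z 1 + Complex.I * fderiv ℝ (dlogNorm F) z Complex.I =
      ((2 * density F z : ℝ) : ℂ) := by
  have h1 : DifferentiableAt ℝ F z := (hF z).restrictScalars ℝ
  have h2 : DifferentiableAt ℝ (deriv F) z := (differentiable_deriv hF z).restrictScalars ℝ
  have hΦ : DifferentiableAt ℝ (dlogNorm F) z :=
    (contDiff_dlogNorm hF).differentiable (by norm_num) z
  have hh : DifferentiableAt ℝ (fun w => 1 + inner ℂ (F w) (F w)) z :=
    (h1.inner ℂ h1).const_add 1
  -- Differentiating this product avoids the quotient rule. Combining the directions `1` and `i`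
  -- then removes the complex-linear terms, among them the second derivative of `F`.
  have hP : (fun w => inner ℂ (F w) (deriv F w)) =
      fun w => dlogNorm F w * (1 + inner ℂ (F w) (F w)) := by
    funext w
    rw [dlogNorm, div_mul_cancel₀ _ (one_add_inner_self_ne_zero (F w))]
  have key : ∀ v : ℂ, inner ℂ (F z) (v • deriv (deriv F) z) + inner ℂ (v • deriv F z) (deriv F z) =
      dlogNorm F z * (inner ℂ (F z) (v • deriv F z) + inner ℂ (v • deriv F z) (F z)) +
        (1 + inner ℂ (F z) (F z)) * fderiv ℝ (dlogNorm F) z v := by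
    intro v
    have e1 := fderiv_inner_apply ℂ h1 h2 v
    rw [hP, fderiv_fun_mul hΦ hh, fderiv_const_add, add_apply, smul_apply, smul_apply,
      fderiv_inner_apply ℂ h1 h1 v, fderiv_real_apply hF,
      fderiv_real_apply (differentiable_deriv hF)] at e1
    simpa only [smul_eq_mul] using e1.symm
  have k1 := key 1
  have k2 := key Complex.I
  simp only [one_smul, inner_smul_left, inner_smul_right, Complex.conj_I] at k1 k2
  have hne := one_add_inner_self_ne_zero (F z)
  have e2 : (1 + inner ℂ (F z) (F z)) *
      (fderiv ℝ (dlogNorm F) z 1 + Complex.I * fderiv ℝ (dlogNorm F) z Complex.I) =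
      2 * inner ℂ (deriv F z) (deriv F z) - 2 * dlogNorm F z * inner ℂ (deriv F z) (F z) := by
    linear_combination -k1 - Complex.I * k2 + (inner ℂ (F z) (deriv (deriv F) z) -
      inner ℂ (deriv F z) (deriv F z) - dlogNorm F z * inner ℂ (F z) (deriv F z)
      + dlogNorm F z * inner ℂ (deriv F z) (F z)) * Complex.I_sq
  rw [← mul_right_inj' hne, e2, dlogNorm, mul_div_assoc', div_mul_eq_mul_div, mul_assoc,
    inner_mul_symm_eq_ofReal, density, one_add_inner_self, inner_self_eq_ofReal]
  rw [one_add_inner_self] at hne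
  push_cast at hne ⊢
  field_simp

theorem continuous_density : Continuous (density F) := by
  have h1 : Continuous F := hF.continuous
  have h2 : Continuous (deriv F) := (differentiable_deriv hF).continuous
  unfold density
  exact Continuous.div (by fun_prop) (by fun_prop) fun z => by positivity

theorem integral_density {t : ℝ} (ht : 0 ≤ t) :
    ∫ z in Metric.closedBall (0 : ℂ) t, density F z =
      (1 / 2) * ∫ θ in (-Real.pi)..Real.pi, (dlogNorm F (circleMap 0 t θ) * circleMap 0 t θ).re := by
  have h := integral_closedBall_dbar (contDiff_dlogNorm hF) ht
  simp_rw [dbar_dlogNorm hF] at h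
  rw [integral_complex_ofReal, integral_const_mul] at h
  have hc : Continuous (dlogNorm F) := (contDiff_dlogNorm hF).continuous
  have h2 := congrArg Complex.re h
  rw [Complex.ofReal_re] at h2
  have h3 := Complex.reCLM.intervalIntegral_comp_comm (μ := volume)
    (f := fun θ => dlogNorm F (circleMap 0 t θ) * circleMap 0 t θ) (a := -Real.pi) (b := Real.pi)
    (Continuous.intervalIntegrable (by fun_prop) _ _)
  simp only [Complex.reCLM_apply] at h3
  rw [h3, ← h2]
  ring

/-- **Jensen's formula** for `log (1 + ‖F‖²)`. -/
theorem integral_integral_density {r : ℝ} (hr : 1 ≤ r) :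
    ∫ t in (1 : ℝ)..r, (1 / t) * ∫ z in Metric.closedBall (0 : ℂ) t, density F z =
      (1 / 4) * ((∫ θ in (-Real.pi)..Real.pi, Real.log (1 + ‖F (circleMap 0 r θ)‖ ^ 2)) -
        ∫ θ in (-Real.pi)..Real.pi, Real.log (1 + ‖F (circleMap 0 1 θ)‖ ^ 2)) := by
  have hc : Continuous (dlogNorm F) := (contDiff_dlogNorm hF).continuous
  have hF' := hF.continuous
  have hcc : Continuous fun p : ℝ × ℝ => circleMap 0 p.1 p.2 := by
    simp only [circleMap]; fun_prop
  have hG : Continuous fun p : ℝ × ℝ =>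
      2 * (dlogNorm F (circleMap 0 p.1 p.2) * Complex.exp (p.2 * Complex.I)).re := by
    refine continuous_const.mul (Complex.continuous_re.comp ((hc.comp hcc).mul (by fun_prop)))
  -- On the circle `z = t e^{iθ}`, so the factor `1 / t` leaves `Re (dlogNorm F z · e^{iθ})`, half
  -- the radial derivative of `log (1 + ‖F‖²)`.
  have h1 : ∀ t ∈ Set.uIcc 1 r, (1 / t) * ∫ z in Metric.closedBall (0 : ℂ) t, density F z =
      (1 / 4) * ∫ θ in (-Real.pi)..Real.pi,
        2 * (dlogNorm F (circleMap 0 t θ) * Complex.exp (θ * Complex.I)).re := by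
    intro t ht
    rw [Set.uIcc_of_le hr] at ht
    have ht0 : 0 < t := by linarith [ht.1]
    rw [integral_density hF ht0.le, ← intervalIntegral.integral_const_mul,
      ← intervalIntegral.integral_const_mul, ← intervalIntegral.integral_const_mul]
    refine intervalIntegral.integral_congr fun θ _ => ?_
    have : dlogNorm F (circleMap 0 t θ) * circleMap 0 t θ =
        (t : ℂ) * (dlogNorm F (circleMap 0 t θ) * Complex.exp (θ * Complex.I)) := by
      generalize dlogNorm F (circleMap 0 t θ) = w
      rw [circleMap_zero]
      ring
    simp only [this, Complex.re_ofReal_mul]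
    field_simp
    ring
  have hu : ∀ s : ℝ, IntervalIntegrable (fun θ => Real.log (1 + ‖F (circleMap 0 s θ)‖ ^ 2)) volume
      (-Real.pi) Real.pi := fun s => by
    refine Continuous.intervalIntegrable (Continuous.log (by fun_prop) fun θ => ?_) _ _
    positivity
  rw [intervalIntegral.integral_congr h1, intervalIntegral.integral_const_mul,
    intervalIntegral_intervalIntegral_swap, ← intervalIntegral.integral_sub (hu r) (hu 1)]
  · congr 1
    refine intervalIntegral.integral_congr fun θ _ => ?_
    refine intervalIntegral.integral_eq_sub_of_hasDerivAt
      (fun t _ => hasDerivAt_log_norm hF t θ) ?_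
    exact (hG.comp (by fun_prop : Continuous fun t : ℝ => (t, θ))).intervalIntegrable _ _
  · exact (hG.continuousOn.integrableOn_compact (isCompact_uIcc.prod isCompact_uIcc)).mono_set
      (Set.prod_mono Set.uIoc_subset_uIcc Set.uIoc_subset_uIcc)

end Density

/-- The images of `∂/∂x` and `∂/∂y` are `F'` and `i F'`, of equal Fubini–Study length; the factors
`2 · 2 / 4` cancel. -/
theorem normDf_sq {n : ℕ} {f : ℂ → X n} (hf : IsHolomorphic f) (z : ℂ) :
    normDf f z ^ 2 = density (coords f) z / Real.pi := by
  have h : ∀ v : ℂ, ‖v‖ = 1 → fubiniStudy (coords f z) (v • deriv (coords f) z)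
      (v • deriv (coords f) z) = density (coords f) z / Real.pi := by
    intro v hv
    have hv' : (starRingEnd ℂ) v * v = 1 := by
      rw [mul_comm, Complex.mul_conj, Complex.normSq_eq_norm_sq, hv]; simp
    rw [fubiniStudy, density]
    have e : ((1 + ‖coords f z‖ ^ 2 : ℝ) * inner ℂ (v • deriv (coords f) z) (v • deriv (coords f) z) -
        inner ℂ (v • deriv (coords f) z) (coords f z) *
          inner ℂ (coords f z) (v • deriv (coords f) z) : ℂ) =
        (((1 + ‖coords f z‖ ^ 2) * ‖deriv (coords f) z‖ ^ 2 -
          ‖inner ℂ (coords f z) (deriv (coords f) z)‖ ^ 2 : ℝ) : ℂ) := by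
      rw [inner_smul_left, inner_smul_right, inner_smul_left, inner_smul_right, Complex.ofReal_sub,
        ← inner_mul_symm_eq_ofReal, Complex.ofReal_mul, ← inner_self_eq_ofReal]
      linear_combination (((1 + ‖coords f z‖ ^ 2 : ℝ) : ℂ) *
        inner ℂ (deriv (coords f) z) (deriv (coords f) z) -
        inner ℂ (coords f z) (deriv (coords f) z) * inner ℂ (deriv (coords f) z) (coords f z)) * hv'
    push_cast at e ⊢
    rw [e]
    norm_cast
    rw [one_div, inv_mul_eq_div]
  have hd := density_nonneg (coords f) z
  rw [normDf, mul_pow, Real.sq_sqrt zero_le_two, normDz, fderiv_real_apply hf, fderiv_real_apply hf,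
    h 1 (by simp), h _ Complex.norm_I, Real.sq_sqrt (by positivity)]
  ring

theorem characteristic_eq {n : ℕ} {f : ℂ → X n} (hf : IsHolomorphic f) {r : ℝ} (hr : 1 ≤ r) :
    characteristic f r = (1 / (4 * Real.pi)) *
      ((∫ θ in (-Real.pi)..Real.pi, Real.log (1 + ‖coords f (circleMap 0 r θ)‖ ^ 2)) -
        ∫ θ in (-Real.pi)..Real.pi, Real.log (1 + ‖coords f (circleMap 0 1 θ)‖ ^ 2)) := by
  have h := integral_integral_density hf hr
  rw [characteristic]
  simp_rw [normDf_sq hf, integral_div, mul_div_assoc']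
  rw [intervalIntegral.integral_div, h]
  field_simp


/-! ### Entire functions -/

/-- Take for `g` a primitive of `f' / f` with `g 0 = log (f 0)`; then `f · exp (-g)` has derivative
zero. -/
theorem exists_eq_exp {f : ℂ → ℂ} (hf : Differentiable ℂ f) (h0 : ∀ z, f z ≠ 0) :
    ∃ g : ℂ → ℂ, Differentiable ℂ g ∧ ∀ z, f z = Complex.exp (g z) := by
  have hd : Differentiable ℂ fun z => deriv f z / f z :=
    (differentiable_deriv hf).div hf h0
  obtain ⟨g, hg0, hg⟩ := hd.isExactOn_univ.with_val_at 0 (Complex.log (f 0))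
  have hg' : ∀ z, HasDerivAt g (deriv f z / f z) z := fun z => hg z (Set.mem_univ z)
  have hk : ∀ z, HasDerivAt (fun w => f w * Complex.exp (-g w)) 0 z := fun z => by
    refine ((hf z).hasDerivAt.mul (hg' z).neg.cexp).congr_deriv ?_
    field_simp [h0 z]
    ring
  refine ⟨g, fun z => (hg' z).differentiableAt, fun z => ?_⟩
  have h1 := is_const_of_deriv_eq_zero (fun z => (hk z).differentiableAt)
    (fun z => (hk z).deriv) z 0
  simp only [hg0, Complex.exp_neg, Complex.exp_log (h0 0), mul_inv_cancel₀ (h0 0)] at h1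
  exact (mul_inv_eq_one₀ (Complex.exp_ne_zero _)).1 h1

/-- The Taylor coefficients at the origin. -/
def taylorCoeff (g : ℂ → ℂ) (m : ℕ) : ℂ := iteratedDeriv m g 0 / m.factorial

theorem integral_circleMap_shift {E : Type*} [NormedAddCommGroup E] [NormedSpace ℝ E] (h : ℂ → E)
    (r : ℝ) : ∫ θ in (-Real.pi)..Real.pi, h (circleMap 0 r θ) =
      ∫ θ in (0 : ℝ)..2 * Real.pi, h (circleMap 0 r θ) := by
  have := ((periodic_circleMap 0 r).comp h).intervalIntegral_add_eq (-Real.pi) 0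
  rw [zero_add, show -Real.pi + 2 * Real.pi = Real.pi by ring] at this
  exact this

section

variable {g : ℂ → ℂ} (hg : Differentiable ℂ g) {r : ℝ} (hr : 0 < r)
include hg hr

theorem integral_mul_circleMap_pow_inv (m : ℕ) :
    ∫ θ in (-Real.pi)..Real.pi, g (circleMap 0 r θ) * (circleMap 0 r θ ^ m)⁻¹ =
      2 * Real.pi * taylorCoeff g m := by
  rw [integral_circleMap_shift (fun z => g z * (z ^ m)⁻¹) r]
  have h := (hg.differentiableOn (s := Metric.closedBall 0 r)).circleIntegral_one_div_sub_center_pow_smul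
    hr m
  rw [circleIntegral] at h
  have h2 : ∀ θ ∈ Set.uIcc 0 (2 * Real.pi), deriv (circleMap 0 r) θ •
      (1 / (circleMap 0 r θ - 0) ^ (m + 1)) • g (circleMap 0 r θ) =
        Complex.I * (g (circleMap 0 r θ) * (circleMap 0 r θ ^ m)⁻¹) := fun θ _ => by
    have : circleMap 0 r θ ≠ 0 := circleMap_ne_center hr.ne'
    rw [deriv_circleMap, smul_eq_mul, smul_eq_mul, sub_zero, pow_succ]
    field_simp
  rw [intervalIntegral.integral_congr h2, intervalIntegral.integral_const_mul] at h
  rw [← mul_right_inj' Complex.I_ne_zero, h, taylorCoeff, smul_eq_mul]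
  ring

theorem integral_re_circleMap :
    ∫ θ in (-Real.pi)..Real.pi, (g (circleMap 0 r θ)).re = 2 * Real.pi * (g 0).re := by
  have h := integral_mul_circleMap_pow_inv hg hr 0
  have hc := hg.continuous
  have h3 := Complex.reCLM.intervalIntegral_comp_comm (μ := volume)
    (f := fun θ => g (circleMap 0 r θ)) (a := -Real.pi) (b := Real.pi)
    (Continuous.intervalIntegrable (by fun_prop) _ _)
  simp only [Complex.reCLM_apply] at h3
  simp only [pow_zero, inv_one, mul_one, taylorCoeff, iteratedDeriv_zero, Nat.factorial_zero,
    Nat.cast_one, div_one] at h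
  rw [h3, h]
  simp

/-- Write `2 Re g = g + ḡ` and integrate against `z⁻ᵐ`. The first summand gives the Taylor
coefficient by Cauchy's formula. The second gives, up to a factor and conjugation, the mean of `g
zᵐ`, which is zero because `g zᵐ` vanishes at the origin for `m ≠ 0`. -/
theorem norm_taylorCoeff_mul_pow_le {m : ℕ} (hm : m ≠ 0) :
    Real.pi * (‖taylorCoeff g m‖ * r ^ m) ≤
      ∫ θ in (-Real.pi)..Real.pi, |(g (circleMap 0 r θ)).re| := by
  have hc := hg.continuous
  have hne : ∀ θ, circleMap 0 r θ ≠ 0 := fun θ => circleMap_ne_center hr.ne'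
  have h1 := integral_mul_circleMap_pow_inv hg hr m
  have h2 := integral_mul_circleMap_pow_inv (hg.mul (differentiable_id.pow m)) hr 0
  simp only [pow_zero, inv_one, mul_one, taylorCoeff, iteratedDeriv_zero, Nat.factorial_zero,
    Nat.cast_one, div_one, Pi.mul_apply, Pi.pow_apply, id, zero_pow hm, mul_zero] at h2
  have h3 : ∫ θ in (-Real.pi)..Real.pi,
      (starRingEnd ℂ) (g (circleMap 0 r θ)) * (circleMap 0 r θ ^ m)⁻¹ = 0 := by
    have e : ∀ θ ∈ Set.uIcc (-Real.pi) Real.pi,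
        (starRingEnd ℂ) (g (circleMap 0 r θ)) * (circleMap 0 r θ ^ m)⁻¹ =
          (((r : ℂ) ^ 2) ^ m)⁻¹ *
            Complex.conjCLE (g (circleMap 0 r θ) * circleMap 0 r θ ^ m) := fun θ _ => by
      have hz : (starRingEnd ℂ) (circleMap 0 r θ) * circleMap 0 r θ = (r : ℂ) ^ 2 := by
        rw [mul_comm, Complex.mul_conj, Complex.normSq_eq_norm_sq, norm_circleMap_zero, sq_abs]
        push_cast; rfl
      have hr' : (r : ℂ) ≠ 0 := by exact_mod_cast hr.ne'
      rw [Complex.conjCLE_apply, map_mul, map_pow, ← hz, mul_pow, mul_inv]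
      have : (starRingEnd ℂ) (circleMap 0 r θ) ≠ 0 := by simpa using hne θ
      field_simp
    rw [intervalIntegral.integral_congr e, intervalIntegral.integral_const_mul]
    have := Complex.conjCLE.toContinuousLinearMap.intervalIntegral_comp_comm (μ := volume)
      (f := fun θ => g (circleMap 0 r θ) * circleMap 0 r θ ^ m) (a := -Real.pi) (b := Real.pi)
      (Continuous.intervalIntegrable (by fun_prop) _ _)
    simp only [ContinuousLinearEquiv.coe_coe] at this
    rw [this, h2, map_zero, mul_zero]
  have hcp : Continuous fun θ => (circleMap 0 r θ ^ m)⁻¹ :=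
    Continuous.inv₀ (by fun_prop) fun θ => pow_ne_zero _ (hne θ)
  have h4 : ∫ θ in (-Real.pi)..Real.pi, (2 * (g (circleMap 0 r θ)).re : ℂ) * (circleMap 0 r θ ^ m)⁻¹ =
      2 * Real.pi * taylorCoeff g m := by
    have hadd := intervalIntegral.integral_add (μ := volume) (a := -Real.pi) (b := Real.pi)
      (f := fun θ => g (circleMap 0 r θ) * (circleMap 0 r θ ^ m)⁻¹)
      (g := fun θ => (starRingEnd ℂ) (g (circleMap 0 r θ)) * (circleMap 0 r θ ^ m)⁻¹)
      (((hc.comp (continuous_circleMap 0 r)).mul hcp).intervalIntegrable _ _)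
      (((Complex.continuous_conj.comp (by fun_prop)).mul hcp).intervalIntegrable _ _)
    rw [h1, h3, add_zero] at hadd
    rw [← hadd]
    refine intervalIntegral.integral_congr fun θ _ => ?_
    rw [← add_mul, Complex.add_conj]
    push_cast; rfl
  have h5 := intervalIntegral.norm_integral_le_integral_norm (μ := volume)
    (f := fun θ => (2 * (g (circleMap 0 r θ)).re : ℂ) * (circleMap 0 r θ ^ m)⁻¹)
    (show -Real.pi ≤ Real.pi by linarith [Real.pi_pos])
  rw [h4] at h5
  have h6 : ∀ θ ∈ Set.uIcc (-Real.pi) Real.pi,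
      ‖(2 * (g (circleMap 0 r θ)).re : ℂ) * (circleMap 0 r θ ^ m)⁻¹‖ =
        2 * (r ^ m)⁻¹ * |(g (circleMap 0 r θ)).re| := fun θ _ => by
    simp [abs_of_pos hr]
    ring
  rw [intervalIntegral.integral_congr h6, intervalIntegral.integral_const_mul] at h5
  have h7 : ‖(2 * Real.pi * taylorCoeff g m : ℂ)‖ = 2 * Real.pi * ‖taylorCoeff g m‖ := by
    simp [abs_of_pos Real.pi_pos]
  rw [h7, mul_assoc, mul_assoc, mul_le_mul_iff_right₀ two_pos, inv_mul_eq_div,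
    le_div_iff₀ (by positivity)] at h5
  linarith

omit hr in
theorem exists_polynomial_of_taylorCoeff_eq_zero {N : ℕ} (h : ∀ m, N < m → taylorCoeff g m = 0) :
    ∃ p : Polynomial ℂ, (∀ z, g z = p.eval z) ∧ ∀ m, p.coeff m = taylorCoeff g m := by
  refine ⟨∑ m ∈ Finset.range (N + 1), Polynomial.monomial m (taylorCoeff g m), fun z => ?_, ?_⟩
  · rw [← Complex.taylorSeries_eq_of_entire' (c := 0) (z := z) hg, tsum_eq_sum (s := Finset.range (N + 1)),
      Polynomial.eval_finsetSum]
    · refine Finset.sum_congr rfl fun m _ => ?_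
      rw [Polynomial.eval_monomial, taylorCoeff, sub_zero, inv_mul_eq_div]
    · intro m hm
      have := h m (by simpa [Nat.lt_succ_iff] using hm)
      rw [taylorCoeff, div_eq_inv_mul] at this
      rw [this, zero_mul]
  · intro m
    simp only [Polynomial.finsetSum_coeff, Polynomial.coeff_monomial, Finset.sum_ite_eq',
      Finset.mem_range]
    split_ifs with hm
    · rfl
    · exact (h m (by omega)).symm

end


/-! ### Logarithmic coordinates -/

theorem coords_ne_zero {n : ℕ} (f : ℂ → X n) (z : ℂ) (i : Fin n) : coords f z i ≠ 0 := by
  obtain ⟨w, hw, h⟩ := (f z).2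
  rw [coords, h, affine_mk]
  exact hw i

theorem exists_coords_eq_exp {n : ℕ} {f : ℂ → X n} (hf : IsHolomorphic f) :
    ∃ g : Fin n → ℂ → ℂ, (∀ i, Differentiable ℂ (g i)) ∧
      ∀ z i, coords f z i = Complex.exp (g i z) := by
  have h : ∀ i, ∃ g : ℂ → ℂ, Differentiable ℂ g ∧ ∀ z, coords f z i = Complex.exp (g z) :=
    fun i => exists_eq_exp (differentiable_euclidean.1 hf i) fun z => coords_ne_zero f z i
  choose g hg hfg using h
  exact ⟨g, hg, fun z i => hfg i z⟩

section

variable {n : ℕ} {f : ℂ → X n} (hf : IsHolomorphic f) {g : Fin n → ℂ → ℂ}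
  (hg : ∀ i, Differentiable ℂ (g i)) (hfg : ∀ z i, coords f z i = Complex.exp (g i z))

include hfg in
theorem norm_coords_sq (z : ℂ) : ‖coords f z‖ ^ 2 = ∑ i, Real.exp (2 * (g i z).re) := by
  rw [EuclideanSpace.norm_sq_eq]
  refine Finset.sum_congr rfl fun i _ => ?_
  rw [hfg, Complex.norm_exp, ← Real.exp_nat_mul]
  norm_num

include hf in
theorem intervalIntegrable_log_norm (r a b : ℝ) :
    IntervalIntegrable (fun θ => Real.log (1 + ‖coords f (circleMap 0 r θ)‖ ^ 2)) volume a b := by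
  have hF' : Continuous (coords f) := hf.continuous
  refine Continuous.intervalIntegrable (Continuous.log (by fun_prop) fun θ => ?_) _ _
  positivity

include hf hg hfg in
theorem taylorCoeff_mul_pow_le_characteristic (i : Fin n) :
    ∃ C : ℝ, ∀ m ≠ 0, ∀ r : ℝ, 1 ≤ r →
      ‖taylorCoeff (g i) m‖ * r ^ m / 4 - C ≤ characteristic f r := by
  refine ⟨(1 / (4 * Real.pi)) * (∫ θ in (-Real.pi)..Real.pi,
    Real.log (1 + ‖coords f (circleMap 0 1 θ)‖ ^ 2)) - (g i 0).re / 2, fun m hm r hr => ?_⟩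
  have hr0 : 0 < r := by linarith
  have hpi := Real.pi_pos
  have hc := (hg i).continuous
  rw [characteristic_eq hf hr]
  -- Here `Re g + |Re g| = 2 max (Re g, 0)`. The mean of `Re g` does not depend on `r`, so the
  -- growth comes from `|Re g|`.
  have h1 : ∫ θ in (-Real.pi)..Real.pi,
      ((g i (circleMap 0 r θ)).re + |(g i (circleMap 0 r θ)).re|) ≤
        ∫ θ in (-Real.pi)..Real.pi, Real.log (1 + ‖coords f (circleMap 0 r θ)‖ ^ 2) := by
    refine intervalIntegral.integral_mono_on (by linarith)
      (Continuous.intervalIntegrable (by fun_prop) _ _)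
      (intervalIntegrable_log_norm hf r _ _) fun θ _ => ?_
    rw [norm_coords_sq hfg]
    have hnn : ∀ j, 0 ≤ Real.exp (2 * (g j (circleMap 0 r θ)).re) := fun j => (Real.exp_pos _).le
    have h2 := Finset.single_le_sum (fun j _ => hnn j) (Finset.mem_univ i)
    have h3 : 0 ≤ ∑ j, Real.exp (2 * (g j (circleMap 0 r θ)).re) :=
      Finset.sum_nonneg fun j _ => hnn j
    rw [Real.le_log_iff_exp_le (by linarith)]
    rcases le_total 0 (g i (circleMap 0 r θ)).re with h | h
    · rw [abs_of_nonneg h, ← two_mul]; linarith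
    · rw [abs_of_nonpos h, add_neg_cancel, Real.exp_zero]; linarith
  rw [intervalIntegral.integral_add (Continuous.intervalIntegrable (by fun_prop) _ _)
    (Continuous.intervalIntegrable (by fun_prop) _ _), integral_re_circleMap (hg i) hr0] at h1
  have h4 := norm_taylorCoeff_mul_pow_le (hg i) hr0 hm
  have h5 : (1 / (4 * Real.pi)) * (2 * Real.pi * (g i 0).re +
      Real.pi * (‖taylorCoeff (g i) m‖ * r ^ m)) ≤ (1 / (4 * Real.pi)) *
        ∫ θ in (-Real.pi)..Real.pi, Real.log (1 + ‖coords f (circleMap 0 r θ)‖ ^ 2) := by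
    gcongr
    linarith
  have h6 : (1 / (4 * Real.pi)) * (2 * Real.pi * (g i 0).re +
      Real.pi * (‖taylorCoeff (g i) m‖ * r ^ m)) =
        (g i 0).re / 2 + ‖taylorCoeff (g i) m‖ * r ^ m / 4 := by
    field_simp
    ring
  rw [h6] at h5
  rw [mul_sub]
  linarith

include hf hfg in
theorem characteristic_le {r M : ℝ} (hr : 1 ≤ r) (hM : 0 ≤ M)
    (h : ∀ i z, ‖z‖ = r → (g i z).re ≤ M) :
    characteristic f r ≤ M + Real.log (n + 1) / 2 := by
  have hpi := Real.pi_pos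
  rw [characteristic_eq hf hr]
  have h1 : 0 ≤ ∫ θ in (-Real.pi)..Real.pi, Real.log (1 + ‖coords f (circleMap 0 1 θ)‖ ^ 2) := by
    refine intervalIntegral.integral_nonneg (by linarith) fun θ _ => Real.log_nonneg ?_
    nlinarith [sq_nonneg ‖coords f (circleMap 0 1 θ)‖]
  have h2 : ∫ θ in (-Real.pi)..Real.pi, Real.log (1 + ‖coords f (circleMap 0 r θ)‖ ^ 2) ≤
      ∫ θ in (-Real.pi)..Real.pi, (Real.log (n + 1) + 2 * M) := by
    refine intervalIntegral.integral_mono_on (by linarith) (intervalIntegrable_log_norm hf r _ _)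
      (by simp) fun θ _ => ?_
    rw [← Real.log_exp (2 * M), ← Real.log_mul (by positivity) (Real.exp_pos _).ne',
      norm_coords_sq hfg]
    refine Real.log_le_log (by positivity) ?_
    have h3 : ∑ i, Real.exp (2 * (g i (circleMap 0 r θ)).re) ≤ ∑ _i : Fin n, Real.exp (2 * M) := by
      gcongr with i
      exact h i _ (by rw [norm_circleMap_zero, abs_of_pos (by linarith)])
    have h4 : 1 ≤ Real.exp (2 * M) := Real.one_le_exp (by linarith)
    simp only [Finset.sum_const, Finset.card_univ, Fintype.card_fin, nsmul_eq_mul] at h3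
    linarith
  rw [intervalIntegral.integral_const, smul_eq_mul] at h2
  calc _ ≤ (1 / (4 * Real.pi)) * ((Real.pi - -Real.pi) * (Real.log (n + 1) + 2 * M)) := by
        gcongr; linarith
    _ = _ := by field_simp; ring

end

/-! ### Polynomials near infinity -/

theorem tendsto_eval_div_pow {p : Polynomial ℂ} {k : ℕ} (hp : p.natDegree ≤ k) :
    Tendsto (fun z => p.eval z / z ^ k) (Bornology.cobounded ℂ) (nhds (p.coeff k)) := by
  have hdeg : (p - Polynomial.monomial k (p.coeff k)).degree < (Polynomial.X ^ k : Polynomial ℂ).degree := by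
    rw [Polynomial.degree_X_pow, Polynomial.degree_lt_iff_coeff_zero]
    intro m hm
    rw [Polynomial.coeff_sub, Polynomial.coeff_monomial]
    split_ifs with h
    · rw [h, sub_self]
    · rw [sub_zero]; exact Polynomial.coeff_eq_zero_of_natDegree_lt (by omega)
  have h := (Polynomial.isLittleO_cobounded_of_degree_lt hdeg).tendsto_div_nhds_zero.add_const (p.coeff k)
  rw [zero_add] at h
  refine h.congr' ?_
  have hne : ∀ᶠ z : ℂ in Bornology.cobounded ℂ, z ≠ 0 := Bornology.eventually_ne_cobounded 0
  filter_upwards [hne] with z hz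
  simp only [Polynomial.eval_sub, Polynomial.eval_monomial, Polynomial.eval_pow, Polynomial.eval_X]
  field_simp
  ring

theorem eventually_sphere_of_cobounded {P : ℂ → Prop} (h : ∀ᶠ z in Bornology.cobounded ℂ, P z) :
    ∀ᶠ r : ℝ in atTop, ∀ z, ‖z‖ = r → P z := by
  rw [← comap_norm_atTop, eventually_comap] at h
  exact h

theorem exists_norm_eval_le_mul_pow {p : Polynomial ℂ} {k : ℕ} (hp : p.natDegree ≤ k) :
    ∃ C : ℝ, 0 < C ∧ ∀ᶠ r : ℝ in atTop, ∀ z, ‖z‖ = r → ‖p.eval z‖ ≤ C * r ^ k := by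
  refine ⟨‖p.coeff k‖ + 1, by positivity, ?_⟩
  have h := (tendsto_eval_div_pow hp).norm.eventually (eventually_le_nhds (lt_add_one _))
  filter_upwards [eventually_sphere_of_cobounded h, eventually_gt_atTop 0] with r hr h0 z hz
  have := hr z hz
  rwa [norm_div, norm_pow, hz, div_le_iff₀ (by positivity)] at this

theorem exists_mul_pow_le_norm_eval {p : Polynomial ℂ} {k : ℕ} (hp : p.natDegree ≤ k)
    (hk : p.coeff k ≠ 0) :
    ∃ c : ℝ, 0 < c ∧ ∀ᶠ r : ℝ in atTop, ∀ z, ‖z‖ = r → c * r ^ k ≤ ‖p.eval z‖ := by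
  have hpos : 0 < ‖p.coeff k‖ := norm_pos_iff.2 hk
  refine ⟨‖p.coeff k‖ / 2, by positivity, ?_⟩
  have h := (tendsto_eval_div_pow hp).norm.eventually (eventually_ge_nhds (half_lt_self hpos))
  filter_upwards [eventually_sphere_of_cobounded h, eventually_gt_atTop 0] with r hr h0 z hz
  have := hr z hz
  rwa [norm_div, norm_pow, hz, le_div_iff₀ (by positivity)] at this


/-! ### Bounds for the energy density -/

/-- Pythagoras for the component of `w` orthogonal to `v`. -/
theorem norm_sq_mul_norm_sub_sq {E : Type*} [NormedAddCommGroup E] [InnerProductSpace ℂ E]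
    {v : E} (hv : v ≠ 0) (w : E) :
    ‖v‖ ^ 2 * ‖w - (inner ℂ v w / inner ℂ v v : ℂ) • v‖ ^ 2 =
      ‖v‖ ^ 2 * ‖w‖ ^ 2 - ‖(inner ℂ v w : ℂ)‖ ^ 2 := by
  have hne : (inner ℂ v v : ℂ) ≠ 0 := inner_self_ne_zero.2 hv
  have hc : (starRingEnd ℂ) (inner ℂ v v) = (inner ℂ v v : ℂ) := inner_conj_symm v v
  rw [← Complex.ofReal_inj, Complex.ofReal_mul, Complex.ofReal_sub, Complex.ofReal_mul,
    ← inner_mul_symm_eq_ofReal, ← inner_self_eq_ofReal, ← inner_self_eq_ofReal,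
    ← inner_self_eq_ofReal]
  simp only [inner_sub_left, inner_sub_right, inner_smul_left, inner_smul_right, map_div₀, hc,
    inner_conj_symm]
  field_simp
  ring

section

variable {n : ℕ} {f : ℂ → X n} (hf : IsHolomorphic f) {g : Fin n → ℂ → ℂ}
  (hg : ∀ i, Differentiable ℂ (g i)) (hfg : ∀ z i, coords f z i = Complex.exp (g i z))
include hf hg hfg

theorem deriv_coords_apply (z : ℂ) (i : Fin n) :
    deriv (coords f) z i = deriv (g i) z * coords f z i := by
  have h1 : HasDerivAt (fun w => coords f w i) (deriv (coords f) z i) z :=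
    ((EuclideanSpace.proj (𝕜 := ℂ) i : EuclideanSpace ℂ (Fin n) →L[ℂ] ℂ).hasFDerivAt).comp_hasDerivAt z
      (hf z).hasDerivAt
  have h2 : HasDerivAt (fun w => coords f w i) (Complex.exp (g i z) * deriv (g i) z) z := by
    simp_rw [hfg]
    exact ((hg i) z).hasDerivAt.cexp
  rw [h1.unique h2, hfg, mul_comm]

/-- Drop the subtracted inner product and use `|Fᵢ'| = |gᵢ'| |Fᵢ| ≤ |gᵢ'| ‖F‖`. -/
theorem density_le (z : ℂ) : density (coords f) z ≤ ∑ i, ‖deriv (g i) z‖ ^ 2 := by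
  rw [density, div_le_iff₀ (by positivity)]
  have h1 : ‖deriv (coords f) z‖ ^ 2 ≤ (∑ i, ‖deriv (g i) z‖ ^ 2) * (1 + ‖coords f z‖ ^ 2) := by
    rw [EuclideanSpace.norm_sq_eq (deriv (coords f) z), Finset.sum_mul]
    refine Finset.sum_le_sum fun i _ => ?_
    rw [deriv_coords_apply hf hg hfg, norm_mul, mul_pow]
    have h2 : ‖coords f z i‖ ^ 2 ≤ ‖coords f z‖ ^ 2 := by
      gcongr
      exact PiLp.norm_apply_le _ i
    gcongr
    linarith
  calc _ ≤ (1 + ‖coords f z‖ ^ 2) * ‖deriv (coords f) z‖ ^ 2 :=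
        sub_le_self _ (sq_nonneg _)
    _ ≤ (1 + ‖coords f z‖ ^ 2) * ((∑ i, ‖deriv (g i) z‖ ^ 2) * (1 + ‖coords f z‖ ^ 2)) := by gcongr
    _ = _ := by ring

/-- At a point where two of the homogeneous coordinates have maximal modulus, the energy density
is bounded below by the difference of their logarithmic derivatives. -/
theorem le_density {G : Option (Fin n) → ℂ → ℂ} (hG0 : G none = 0) (hG : ∀ i, G (some i) = g i)
    {z : ℂ} {i j : Option (Fin n)} (hij : (G i z).re = (G j z).re)
    (hmax : ∀ l, (G l z).re ≤ (G i z).re) :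
    ‖deriv (G i) z - deriv (G j) z‖ ^ 2 / (2 * (n + 1)) ≤ density (coords f) z := by
  rcases eq_or_ne i j with rfl | hne
  · simpa using density_nonneg (coords f) z
  -- `V` is the lift of `f` to homogeneous coordinates and `W` its derivative. The density is the
  -- squared norm of the part of `W` orthogonal to `V`, divided by `‖V‖²`.
  set V : EuclideanSpace ℂ (Option (Fin n)) := WithLp.toLp 2 fun l => Complex.exp (G l z) with hV
  set W : EuclideanSpace ℂ (Option (Fin n)) :=
    WithLp.toLp 2 fun l => deriv (G l) z * Complex.exp (G l z) with hW
  have hVn : ‖V‖ ^ 2 = 1 + ‖coords f z‖ ^ 2 := by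
    rw [EuclideanSpace.norm_sq_eq, EuclideanSpace.norm_sq_eq, Fintype.sum_option]
    simp [hV, hG0, hG, hfg]
  have hWn : ‖W‖ ^ 2 = ‖deriv (coords f) z‖ ^ 2 := by
    rw [EuclideanSpace.norm_sq_eq, EuclideanSpace.norm_sq_eq, Fintype.sum_option]
    simp [hW, hG0, hG, hfg, deriv_coords_apply hf hg hfg]
  have hVW : inner ℂ V W = inner ℂ (coords f z) (deriv (coords f) z) := by
    rw [PiLp.inner_apply, PiLp.inner_apply, Fintype.sum_option]
    simp [hV, hW, hG0, hG, hfg, deriv_coords_apply hf hg hfg]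
  have hV2 : 0 < ‖V‖ ^ 2 := by rw [hVn]; positivity
  have hV0 : V ≠ 0 := fun h => by simp [h] at hV2
  have key := norm_sq_mul_norm_sub_sq hV0 W
  set c : ℂ := inner ℂ V W / inner ℂ V V
  have hden : density (coords f) z = ‖W - c • V‖ ^ 2 / ‖V‖ ^ 2 := by
    rw [density, ← hVW, ← hVn, ← hWn, ← key]
    field_simp
  set M := Real.exp (G i z).re ^ 2 with hM
  have hM0 : 0 < M := by positivity
  have hVM : ‖V‖ ^ 2 ≤ (n + 1) * M := by
    rw [EuclideanSpace.norm_sq_eq]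
    calc ∑ l, ‖V l‖ ^ 2 ≤ ∑ _l : Option (Fin n), M := by
          refine Finset.sum_le_sum fun l _ => ?_
          simp only [hV, Complex.norm_exp, hM]
          exact pow_le_pow_left₀ (Real.exp_pos _).le (Real.exp_le_exp.2 (hmax l)) 2
      _ = _ := by simp
  -- Only the components `i` and `j` are kept; both have modulus squared `M`. Whatever `c` is, it
  -- cannot be close to both logarithmic derivatives if these differ.
  have hWV : M * (‖deriv (G i) z - c‖ ^ 2 + ‖deriv (G j) z - c‖ ^ 2) ≤ ‖W - c • V‖ ^ 2 := by
    have h1 : ∀ l, ‖(W - c • V) l‖ ^ 2 = Real.exp (G l z).re ^ 2 * ‖deriv (G l) z - c‖ ^ 2 := by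
      intro l
      have : (W - c • V) l = Complex.exp (G l z) * (deriv (G l) z - c) := by
        simp [hV, hW]; ring
      rw [this, norm_mul, mul_pow, Complex.norm_exp]
    have h2 := Finset.sum_le_sum_of_subset_of_nonneg (Finset.subset_univ {i, j})
      fun l _ _ => sq_nonneg ‖(W - c • V) l‖
    rw [← EuclideanSpace.norm_sq_eq, Finset.sum_pair hne, h1, h1, ← hij] at h2
    linarith
  have htri : ‖deriv (G i) z - deriv (G j) z‖ ^ 2 ≤
      2 * (‖deriv (G i) z - c‖ ^ 2 + ‖deriv (G j) z - c‖ ^ 2) := by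
    have h1 : ‖deriv (G i) z - deriv (G j) z‖ ≤ ‖deriv (G i) z - c‖ + ‖deriv (G j) z - c‖ := by
      rw [← sub_sub_sub_cancel_right _ _ c]; exact norm_sub_le _ _
    calc _ ≤ (‖deriv (G i) z - c‖ + ‖deriv (G j) z - c‖) ^ 2 := by gcongr
      _ ≤ _ := by nlinarith [sq_nonneg (‖deriv (G i) z - c‖ - ‖deriv (G j) z - c‖)]
  rw [hden, div_le_div_iff₀ (by positivity) hV2]
  calc _ ≤ (2 * (‖deriv (G i) z - c‖ ^ 2 + ‖deriv (G j) z - c‖ ^ 2)) * ((n + 1) * M) := by gcongr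
    _ = (M * (‖deriv (G i) z - c‖ ^ 2 + ‖deriv (G j) z - c‖ ^ 2)) * (2 * (n + 1)) := by ring
    _ ≤ _ := by gcongr

end

/-! ### Points where the dominant exponential changes -/

theorem tendsto_re_eval_div_pow {p : Polynomial ℂ} {k : ℕ} (hp : p.natDegree ≤ k) {e : ℂ}
    (he : ‖e‖ = 1) :
    Tendsto (fun r : ℝ => (p.eval (r * e)).re / r ^ k) atTop (nhds (p.coeff k * e ^ k).re) := by
  have h1 : Tendsto (fun r : ℝ => (r : ℂ) * e) atTop (Bornology.cobounded ℂ) := by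
    rw [← tendsto_norm_atTop_iff_cobounded]
    simp only [norm_mul, he, mul_one, Complex.norm_real, Real.norm_eq_abs]
    exact tendsto_abs_atTop_atTop
  have he0 : e ≠ 0 := by rintro rfl; simp at he
  have h2 := (((tendsto_eval_div_pow hp).comp h1).mul_const (e ^ k))
  refine ((Complex.continuous_re.tendsto _).comp h2).congr' ?_
  filter_upwards [eventually_gt_atTop 0] with r hr
  have hr' : (r : ℂ) ≠ 0 := by exact_mod_cast hr.ne'
  simp only [Function.comp_apply]
  rw [← Complex.div_ofReal_re]
  congr 1
  push_cast
  field_simp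
  ring

theorem exists_norm_one_mul_pow_eq {a b : ℂ} (ha : a ≠ 0) (hab : ‖b‖ = ‖a‖) {k : ℕ} (hk : k ≠ 0) :
    ∃ e : ℂ, ‖e‖ = 1 ∧ a * e ^ k = b := by
  obtain ⟨e, he⟩ := IsAlgClosed.exists_pow_nat_eq (b / a) (Nat.pos_of_ne_zero hk)
  have h1 : ‖e‖ ^ k = 1 := by
    rw [← norm_pow, he, norm_div, hab, div_self (norm_ne_zero_iff.2 ha)]
  exact ⟨e, (pow_eq_one_iff_of_nonneg (norm_nonneg _) hk).1 h1, by rw [he, mul_div_cancel₀ _ ha]⟩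

/-- Equality would force `b * e` to be the positive real `‖a‖ = a * e` or zero, hence `b = a`. -/
theorem re_mul_lt_norm {a b e : ℂ} (he : ‖e‖ = 1) (ha : a * e = ‖a‖) (hb : ‖b‖ ≤ ‖a‖) (hne : b ≠ a) :
    (b * e).re < ‖a‖ := by
  have he0 : e ≠ 0 := by rintro rfl; simp at he
  have h1 : ‖b * e‖ = ‖b‖ := by rw [norm_mul, he, mul_one]
  refine lt_of_le_of_ne (((Complex.re_le_norm _).trans_eq h1).trans hb) fun h => hne ?_
  have h2 : (b * e).re = ‖b * e‖ := le_antisymm (Complex.re_le_norm _) (by rw [h1, h]; exact hb)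
  have h3 : b * e = ((b * e).re : ℂ) := by
    have h4 := (Complex.nonneg_iff.1 (Complex.re_eq_norm.1 h2)).2
    exact Complex.ext (by simp) (by rw [← h4, Complex.ofReal_im])
  rw [h, ← ha] at h3
  exact mul_right_cancel₀ he0 h3

/-- Let `a` be a coefficient of degree `k` of largest modulus, and split the indices according to
whether their coefficient equals `a`. In the direction `e₁`, where `a e₁ᵏ = ‖a‖`, the first class
dominates; in the direction `e₂`, where `a e₂ᵏ = -‖a‖`, it falls below the zero polynomial `p o`,
which lies in the second class. As the circle is connected, the maxima of the two classes agree
somewhere on it. -/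
theorem eventually_exists_re_eval_eq {ι : Type*} [Fintype ι]
    {p : ι → Polynomial ℂ} {k : ℕ}
    (hk : k ≠ 0) (hp : ∀ i, (p i).natDegree ≤ k) {o : ι} (ho : p o = 0)
    (hex : ∃ i, (p i).coeff k ≠ 0) :
    ∀ᶠ r : ℝ in atTop, ∃ z : ℂ, ‖z‖ = r ∧ ∃ i j, (p i).coeff k ≠ (p j).coeff k ∧
      ((p i).eval z).re = ((p j).eval z).re ∧ ∀ l, ((p l).eval z).re ≤ ((p i).eval z).re := by
  have : Nonempty ι := ⟨o⟩
  obtain ⟨i₀, hi₀⟩ := Finite.exists_max fun i => ‖(p i).coeff k‖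
  set a := (p i₀).coeff k with ha
  have ha0 : a ≠ 0 := by
    obtain ⟨i, hi⟩ := hex
    exact norm_pos_iff.1 ((norm_pos_iff.2 hi).trans_le (hi₀ i))
  obtain ⟨e₁, he₁, hae₁⟩ := exists_norm_one_mul_pow_eq ha0 (b := (‖a‖ : ℂ)) (by simp) hk
  obtain ⟨e₂, he₂, hae₂⟩ := exists_norm_one_mul_pow_eq ha0 (b := -(‖a‖ : ℂ)) (by simp) hk
  classical
  set S : Finset ι := {i | (p i).coeff k = a} with hS
  set T : Finset ι := {i | (p i).coeff k ≠ a} with hT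
  have hSn : S.Nonempty := ⟨i₀, by simp [hS, ha]⟩
  have hoT : o ∈ T := by simpa [hT, ho] using ha0.symm
  have hTn : T.Nonempty := ⟨o, hoT⟩
  have h1 : ∀ᶠ r : ℝ in atTop, ∀ j ∈ T, ((p j).eval (r * e₁)).re < ((p i₀).eval (r * e₁)).re := by
    refine (T.eventually_all).2 fun j hj => ?_
    have hlt : ((p j).coeff k * e₁ ^ k).re < ((p i₀).coeff k * e₁ ^ k).re := by
      rw [← ha, hae₁, Complex.ofReal_re]
      exact re_mul_lt_norm (by rw [norm_pow, he₁, one_pow]) hae₁ (hi₀ j) (by simpa [hT] using hj)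
    filter_upwards [(tendsto_re_eval_div_pow (hp j) he₁).eventually_lt
      (tendsto_re_eval_div_pow (hp i₀) he₁) hlt, eventually_gt_atTop 0] with r hr h0
    exact (div_lt_div_iff_of_pos_right (by positivity)).1 hr
  have h2 : ∀ᶠ r : ℝ in atTop, ∀ i ∈ S, ((p i).eval (r * e₂)).re < 0 := by
    refine (S.eventually_all).2 fun i hi => ?_
    have hia : (p i).coeff k = a := by simpa [hS] using hi
    have hlt : ((p i).coeff k * e₂ ^ k).re < 0 := by
      rw [hia, hae₂]
      simpa using ha0
    filter_upwards [(tendsto_re_eval_div_pow (hp i) he₂).eventually_lt_const hlt,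
      eventually_gt_atTop 0] with r hr h0
    have := (div_lt_iff₀ (by positivity)).1 hr
    rwa [zero_mul] at this
  filter_upwards [h1, h2, eventually_gt_atTop 0] with r hr1 hr2 h0
  set u : ℂ → ℝ := fun z => S.sup' hSn fun i => ((p i).eval z).re
  set v : ℂ → ℝ := fun z => T.sup' hTn fun i => ((p i).eval z).re
  have hu : Continuous u := Continuous.finset_sup'_apply hSn fun i _ =>
    Complex.continuous_re.comp (p i).continuous
  have hv : Continuous v := Continuous.finset_sup'_apply hTn fun i _ =>
    Complex.continuous_re.comp (p i).continuous
  have hmem : ∀ e : ℂ, ‖e‖ = 1 → (r : ℂ) * e ∈ Metric.sphere (0 : ℂ) r := fun e he => by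
    simp [he, abs_of_pos h0]
  have hd1 : v (r * e₁) ≤ u (r * e₁) :=
    Finset.sup'_le _ _ fun j hj => (hr1 j hj).le.trans
      (Finset.le_sup' (fun i => ((p i).eval (r * e₁)).re) (by simp [hS, ha]))
  have hd2 : u (r * e₂) ≤ v (r * e₂) := by
    refine Finset.sup'_le _ _ fun i hi => (hr2 i hi).le.trans ?_
    have := Finset.le_sup' (fun i => ((p i).eval (r * e₂)).re) hoT
    simpa [ho] using this
  have hconn : IsPreconnected (Metric.sphere (0 : ℂ) r) :=
    isPreconnected_sphere (by rw [Complex.rank_real_complex]; norm_num) 0 r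
  obtain ⟨z, hz, huv⟩ := hconn.intermediate_value₂ (hmem e₂ he₂) (hmem e₁ he₁) hu.continuousOn
    hv.continuousOn hd2 hd1
  obtain ⟨i, hi, hui⟩ := Finset.exists_mem_eq_sup' hSn fun i => ((p i).eval z).re
  obtain ⟨j, hj, hvj⟩ := Finset.exists_mem_eq_sup' hTn fun i => ((p i).eval z).re
  have hij : ((p i).eval z).re = ((p j).eval z).re := hui.symm.trans (huv.trans hvj)
  refine ⟨z, by simpa using hz, i, j, ?_, hij, fun l => ?_⟩
  · have e1 : (p i).coeff k = a := by simpa [hS] using hi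
    have e2 : (p j).coeff k ≠ a := by simpa [hT] using hj
    rw [e1]; exact e2.symm
  · by_cases hl : (p l).coeff k = a
    · exact (Finset.le_sup' (fun i => ((p i).eval z).re) (by simpa [hS] using hl)).trans_eq hui
    · rw [hij]
      exact (Finset.le_sup' (fun i => ((p i).eval z).re) (by simpa [hT] using hl)).trans_eq hvj


/-! ### The order and the growth exponent -/

theorem normDf_nonneg {n : ℕ} (f : ℂ → X n) (z : ℂ) : 0 ≤ normDf f z :=
  mul_nonneg (Real.sqrt_nonneg _) (Real.sqrt_nonneg _)

theorem growthExponent_le_of_normDf_le {n : ℕ} {f : ℂ → X n} {C : ℝ} (hC : 0 < C) {d : ℕ}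
    (h : ∀ᶠ r : ℝ in atTop, ∀ z, ‖z‖ = r → normDf f z ≤ C * r ^ d) :
    growthExponent f ≤ ((d : ℝ) : EReal) := by
  refine limsup_div_log_le hC ?_
  filter_upwards [h] with r hr
  rw [Real.rpow_natCast]
  exact iSup₂_le fun z hz => elog_mono (hr z (by simpa using hz))

theorem le_growthExponent_of_le_normDf {n : ℕ} {f : ℂ → X n} {c : ℝ} (hc : 0 < c) {d : ℕ}
    (h : ∀ᶠ r : ℝ in atTop, ∃ z, ‖z‖ = r ∧ c * r ^ d ≤ normDf f z) :
    ((d : ℝ) : EReal) ≤ growthExponent f := by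
  refine le_limsup_div_log hc ?_
  filter_upwards [h] with r hr
  obtain ⟨z, hz, hle⟩ := hr
  rw [Real.rpow_natCast]
  exact (elog_mono hle).trans
    (le_iSup₂_of_le (f := fun z _ => elog (normDf f z)) z (by simpa using hz) le_rfl)

/-- A map whose differential has polynomial growth has finite order. -/
theorem order_lt_top_of_growthExponent_lt_top {n : ℕ} {f : ℂ → X n} (hf : IsHolomorphic f)
    (h : growthExponent f < ⊤) : order f < ⊤ := by
  obtain ⟨N, hN⟩ := eventually_le_elog_pow h
  obtain ⟨R, hR⟩ := eventually_atTop.1 (hN.and (eventually_ge_atTop 1))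
  have hbig : ∀ z : ℂ, R ≤ ‖z‖ → normDf f z ≤ ‖z‖ ^ N := fun z hz => by
    have h1 := (hR _ hz).1
    refine le_of_elog_le_elog (by positivity) (le_trans ?_ h1)
    exact le_iSup₂_of_le (f := fun w _ => elog (normDf f w)) z (by simp) le_rfl
  obtain ⟨B, hB⟩ := (isCompact_closedBall (0 : ℂ) R).exists_bound_of_continuousOn
    (continuous_density hf).continuousOn
  have hB' : ∀ z : ℂ, ‖z‖ ≤ R → normDf f z ^ 2 ≤ |B| / Real.pi := fun z hz => by
    rw [normDf_sq hf]
    gcongr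
    exact ((le_abs_self _).trans (hB z (by simpa using hz))).trans (le_abs_self B)
  -- The compactness bound serves inside radius `R`; the summand `1` makes `K ≥ 1`, as needed
  -- outside.
  set K := |B| / Real.pi + 1 with hK
  have hK0 : 0 < K := by positivity
  have hall : ∀ t : ℝ, 1 ≤ t → ∀ z : ℂ, ‖z‖ ≤ t → normDf f z ^ 2 ≤ K * t ^ (2 * N) := by
    intro t ht z hz
    have h1 : 1 ≤ t ^ (2 * N) := one_le_pow₀ ht
    rcases le_total R ‖z‖ with hz' | hz'
    · calc normDf f z ^ 2 ≤ (‖z‖ ^ N) ^ 2 := pow_le_pow_left₀ (normDf_nonneg f z) (hbig z hz') 2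
        _ ≤ (t ^ N) ^ 2 := by gcongr
        _ = 1 * t ^ (2 * N) := by rw [one_mul, ← pow_mul, mul_comm]
        _ ≤ K * t ^ (2 * N) := by
          gcongr
          rw [hK]
          exact le_add_of_nonneg_left (by positivity)
    · calc normDf f z ^ 2 ≤ K * 1 := by rw [mul_one]; linarith [hB' z hz']
        _ ≤ K * t ^ (2 * N) := by gcongr
  have hT : ∀ r : ℝ, 1 ≤ r → characteristic f r ≤ K * Real.pi * r ^ (2 * N + 2) := by
    intro r hr
    have h1 : ∀ t ∈ Set.uIoc 1 r, ‖(1 / t) * ∫ z in Metric.closedBall (0 : ℂ) t, normDf f z ^ 2‖ ≤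
        K * Real.pi * r ^ (2 * N + 1) := by
      intro t ht
      rw [Set.uIoc_of_le hr] at ht
      have ht0 : 0 < t := by linarith [ht.1]
      have h2 := norm_setIntegral_le_of_norm_le_const (μ := volume)
        (s := Metric.closedBall (0 : ℂ) t) (f := fun z => normDf f z ^ 2)
        (C := K * t ^ (2 * N)) measure_closedBall_lt_top fun z hz => by
          rw [Real.norm_of_nonneg (sq_nonneg _)]
          exact hall t ht.1.le z (by simpa using hz)
      have h3 : volume.real (Metric.closedBall (0 : ℂ) t) = Real.pi * t ^ 2 := by
        rw [Measure.real, Complex.volume_closedBall]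
        simp [ht0.le, mul_comm]
      rw [h3] at h2
      rw [norm_mul, Real.norm_of_nonneg (by positivity : 0 ≤ 1 / t)]
      calc _ ≤ (1 / t) * (K * t ^ (2 * N) * (Real.pi * t ^ 2)) := by gcongr
        _ = K * Real.pi * t ^ (2 * N + 1) := by field_simp; ring
        _ ≤ _ := by gcongr; exact ht.2
    have h4 := intervalIntegral.norm_integral_le_of_norm_le_const h1
    rw [abs_of_nonneg (by linarith)] at h4
    calc characteristic f r ≤ K * Real.pi * r ^ (2 * N + 1) * (r - 1) := (le_abs_self _).trans h4
      _ ≤ K * Real.pi * r ^ (2 * N + 1) * r := by gcongr; linarith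
      _ = _ := by ring
  have hle : order f ≤ (((2 * N + 2 : ℕ) : ℝ) : EReal) := by
    refine limsup_div_log_le (C := K * Real.pi) (by positivity) ?_
    filter_upwards [eventually_ge_atTop 1] with r hr
    rw [Real.rpow_natCast]
    exact elog_mono (hT r hr)
  exact hle.trans_lt (EReal.coe_lt_top _)

section

variable {n : ℕ} {f : ℂ → X n}

/-- A map of finite order is the exponential of polynomials. -/
theorem exists_polynomial_of_order_lt_top (hf : IsHolomorphic f) (h : order f < ⊤) :
    ∃ p : Fin n → Polynomial ℂ, ∀ z i, coords f z i = Complex.exp ((p i).eval z) := by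
  obtain ⟨g, hg, hfg⟩ := exists_coords_eq_exp hf
  obtain ⟨N, hN⟩ := eventually_le_elog_pow h
  have hp : ∀ i, ∃ p : Polynomial ℂ, (∀ z, g i z = p.eval z) ∧
      ∀ m, p.coeff m = taylorCoeff (g i) m := by
    intro i
    refine exists_polynomial_of_taylorCoeff_eq_zero (hg i) (N := N) fun m hm => ?_
    by_contra hne
    obtain ⟨C, hC⟩ := taylorCoeff_mul_pow_le_characteristic hf hg hfg i
    have ha : 0 < ‖taylorCoeff (g i) m‖ := norm_pos_iff.2 hne
    -- The threshold makes `‖aₘ‖ r > 4 (1 + |C|)`, so that `‖aₘ‖ rᵐ / 4 - C` exceeds `r ^ N`.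
    obtain ⟨r, h1, hr1, hr2⟩ := (hN.and ((eventually_ge_atTop 1).and
      (eventually_gt_atTop (4 * (1 + |C|) / ‖taylorCoeff (g i) m‖)))).exists
    have hr0 : 0 < r := by linarith
    have h2 := le_of_elog_le_elog (by positivity) h1
    have h3 := hC m (by omega) r hr1
    have h4 : r ^ (N + 1) ≤ r ^ m := pow_le_pow_right₀ hr1 hm
    have h5 : 1 ≤ r ^ N := one_le_pow₀ hr1
    rw [div_lt_iff₀ ha] at hr2
    have h6 : ‖taylorCoeff (g i) m‖ * r ^ (N + 1) ≤ ‖taylorCoeff (g i) m‖ * r ^ m := by gcongr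
    have h7 : 4 * (1 + |C|) * r ^ N < r * ‖taylorCoeff (g i) m‖ * r ^ N := by gcongr
    have h8 : |C| * 1 ≤ |C| * r ^ N := by gcongr
    have h9 : ‖taylorCoeff (g i) m‖ * r ^ (N + 1) = r * ‖taylorCoeff (g i) m‖ * r ^ N := by ring
    linarith [le_abs_self C]
  choose p hp _ using hp
  exact ⟨p, fun z i => by rw [hfg, hp]⟩

/-! ### Both exponents for exponentials of polynomials -/

theorem taylorCoeff_eval (p : Polynomial ℂ) (m : ℕ) :
    taylorCoeff (fun z => p.eval z) m = p.coeff m := by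
  have h : iteratedDeriv m (fun z => p.eval z) 0 = (Polynomial.derivative^[m] p).eval 0 := by
    rw [iteratedDeriv_eq_iterate]
    induction m generalizing p with
    | zero => rfl
    | succ m ih =>
      rw [Function.iterate_succ_apply, Function.iterate_succ_apply, ← ih]
      exact congrFun (congrArg _ (funext fun z => p.deriv)) 0
  rw [taylorCoeff, h, ← Polynomial.coeff_zero_eq_eval_zero, Polynomial.coeff_iterate_derivative,
    zero_add, Nat.descFactorial_self, nsmul_eq_mul, mul_div_cancel_left₀]
  exact_mod_cast m.factorial_ne_zero

variable (hf : IsHolomorphic f) {p : Fin n → Polynomial ℂ}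
  (hfp : ∀ z i, coords f z i = Complex.exp ((p i).eval z)) {k : ℕ}
  (hk : ∀ i, (p i).natDegree ≤ k)
include hf hfp hk

theorem order_le : order f ≤ ((k : ℝ) : EReal) := by
  choose C hC hCr using fun i => exists_norm_eval_le_mul_pow (hk i)
  have hsum : 0 ≤ ∑ i, C i := Finset.sum_nonneg fun i _ => (hC i).le
  have hlog : 0 ≤ Real.log (n + 1) := Real.log_nonneg (by linarith [n.cast_nonneg (α := ℝ)])
  refine limsup_div_log_le (C := ∑ i, C i + Real.log (n + 1) / 2 + 1) (by positivity) ?_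
  filter_upwards [eventually_all.2 hCr, eventually_ge_atTop 1] with r hr hr1
  rw [Real.rpow_natCast]
  refine elog_mono ?_
  have h1 : 1 ≤ r ^ k := one_le_pow₀ hr1
  refine (characteristic_le hf hfp hr1 (M := (∑ i, C i) * r ^ k) (by positivity)
    fun i z hz => ?_).trans ?_
  · refine (Complex.re_le_norm _).trans ((hr i z hz).trans ?_)
    gcongr
    exact Finset.single_le_sum (fun i _ => (hC i).le) (Finset.mem_univ i)
  · have h2 : Real.log (n + 1) / 2 * 1 ≤ Real.log (n + 1) / 2 * r ^ k := by gcongr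
    linarith

omit hk in
theorem le_order (hk0 : k ≠ 0) {i : Fin n} (hi : (p i).coeff k ≠ 0) :
    ((k : ℝ) : EReal) ≤ order f := by
  obtain ⟨C, hC⟩ := taylorCoeff_mul_pow_le_characteristic hf
    (fun i => (p i).differentiable) hfp i
  have ha : 0 < ‖(p i).coeff k‖ := norm_pos_iff.2 hi
  -- Half of the factor `1 / 4` in the lower bound is given up to absorb the constant `C`.
  refine le_limsup_div_log (C := ‖(p i).coeff k‖ / 8) (by positivity) ?_
  filter_upwards [eventually_ge_atTop 1, (tendsto_pow_atTop hk0).eventually_ge_atTop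
    (8 * C / ‖(p i).coeff k‖)] with r hr1 hr2
  rw [Real.rpow_natCast]
  refine elog_mono (le_trans ?_ (hC k hk0 r hr1))
  rw [taylorCoeff_eval]
  rw [div_le_iff₀ ha] at hr2
  linarith

theorem growthExponent_le : growthExponent f ≤ (((k - 1 : ℕ) : ℝ) : EReal) := by
  have hk' : ∀ i, (Polynomial.derivative (p i)).natDegree ≤ k - 1 := fun i =>
    (Polynomial.natDegree_derivative_le _).trans (Nat.sub_le_sub_right (hk i) 1)
  choose C hC hCr using fun i => exists_norm_eval_le_mul_pow (hk' i)
  have hsum : 0 ≤ ∑ i, C i := Finset.sum_nonneg fun i _ => (hC i).le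
  refine growthExponent_le_of_normDf_le (C := ∑ i, C i + 1) (by positivity) ?_
  filter_upwards [eventually_all.2 hCr, eventually_ge_atTop 1] with r hr hr1 z hz
  have h0 : 0 ≤ r ^ (k - 1) := by positivity
  refine le_trans (abs_le_of_sq_le_sq' (b := (∑ i, C i) * r ^ (k - 1)) ?_ (by positivity)).2
    (by nlinarith)
  have hd := density_le hf (fun i => (p i).differentiable) hfp z
  calc normDf f z ^ 2 = density (coords f) z / Real.pi := normDf_sq hf z
    _ ≤ density (coords f) z := div_le_self (density_nonneg _ _) (by linarith [Real.pi_gt_three])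
    _ ≤ ∑ i, ‖deriv (fun w => (p i).eval w) z‖ ^ 2 := hd
    _ ≤ ∑ i, (C i * r ^ (k - 1)) ^ 2 := by
        refine Finset.sum_le_sum fun i _ => pow_le_pow_left₀ (norm_nonneg _) ?_ 2
        rw [Polynomial.deriv]
        exact hr i z hz
    _ ≤ (∑ i, C i * r ^ (k - 1)) ^ 2 :=
        Finset.sum_sq_le_sq_sum_of_nonneg fun i _ => mul_nonneg (hC i).le h0
    _ = _ := by rw [Finset.sum_mul]

theorem le_growthExponent (hk0 : k ≠ 0) (hex : ∃ i, (p i).coeff k ≠ 0) :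
    (((k - 1 : ℕ) : ℝ) : EReal) ≤ growthExponent f := by
  obtain ⟨d, rfl⟩ := Nat.exists_eq_succ_of_ne_zero hk0
  -- The index `none` stands for the homogeneous coordinate `1 = exp 0`.
  set P : Option (Fin n) → Polynomial ℂ := fun l => l.elim 0 p with hP
  have hPk : ∀ l, (P l).natDegree ≤ d + 1 := by
    rintro (_ | i)
    · simp [hP]
    · exact hk i
  -- The tied pair varies with `r`, so a constant is fixed for each pair and the least one is used;
  -- pairs with equal coefficients get a dummy value.
  have hc : ∀ q : Option (Fin n) × Option (Fin n), ∃ c : ℝ, 0 < c ∧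
      ((P q.1).coeff (d + 1) ≠ (P q.2).coeff (d + 1) → ∀ᶠ r : ℝ in atTop, ∀ z, ‖z‖ = r →
        c * r ^ d ≤ ‖(Polynomial.derivative (P q.1 - P q.2)).eval z‖) := by
    rintro ⟨i, j⟩
    by_cases h : (P i).coeff (d + 1) = (P j).coeff (d + 1)
    · exact ⟨1, one_pos, fun h' => absurd h h'⟩
    · have h1 : (Polynomial.derivative (P i - P j)).natDegree ≤ d :=
        (Polynomial.natDegree_derivative_le _).trans
          (Nat.sub_le_sub_right ((Polynomial.natDegree_sub_le_of_le (hPk i) (hPk j)).trans_eq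
            (max_self _)) 1)
      have h2 : (Polynomial.derivative (P i - P j)).coeff d ≠ 0 := by
        rw [Polynomial.coeff_derivative, Polynomial.coeff_sub]
        exact mul_ne_zero (sub_ne_zero.2 h) (by exact_mod_cast d.succ_ne_zero)
      obtain ⟨c, hc, h3⟩ := exists_mul_pow_le_norm_eval h1 h2
      exact ⟨c, hc, fun _ => h3⟩
  choose c hc0 hc using hc
  obtain ⟨q₀, hq₀⟩ := Finite.exists_min c
  have hpi := Real.pi_pos
  refine le_growthExponent_of_le_normDf (c := c q₀ / Real.sqrt (2 * (n + 1) * Real.pi))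
    (div_pos (hc0 q₀) (Real.sqrt_pos.2 (by positivity))) ?_
  have hcross := eventually_exists_re_eval_eq hk0 hPk (o := none) rfl
    (hex.imp' some fun i hi => hi)
  filter_upwards [hcross, eventually_all.2 fun q => eventually_imp_distrib_left.2 (hc q),
    eventually_ge_atTop 0] with r ⟨z, hz, i, j, hij, hre, hmax⟩ hcr hr0
  refine ⟨z, hz, ?_⟩
  have h1 := le_density hf (fun i => (p i).differentiable) hfp (G := fun l z => (P l).eval z)
    (by funext z; simp [hP]) (fun i => rfl) hre hmax
  have h2 := hcr (i, j) hij z hz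
  rw [Polynomial.derivative_sub, Polynomial.eval_sub] at h2
  simp only [Polynomial.deriv] at h1
  have h3 : c q₀ * r ^ d ≤ ‖(Polynomial.derivative (P i)).eval z -
      (Polynomial.derivative (P j)).eval z‖ :=
    (mul_le_mul_of_nonneg_right (hq₀ (i, j)) (by positivity)).trans h2
  refine abs_le_of_sq_le_sq' (a := c q₀ / Real.sqrt (2 * (n + 1) * Real.pi) * r ^ d) ?_
    (normDf_nonneg f z) |>.2
  rw [normDf_sq hf, div_mul_eq_mul_div, div_pow, Real.sq_sqrt (by positivity),
    ← div_div]
  gcongr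
  refine le_trans ?_ h1
  have := hc0 q₀
  gcongr

end

/-- Otherwise all affine coordinates are constant, and these determine a point of `X`. -/
theorem exists_natDegree_ne_zero {n : ℕ} {f : ℂ → X n} {p : Fin n → Polynomial ℂ}
    (hfp : ∀ z i, coords f z i = Complex.exp ((p i).eval z)) (h : ¬ ∃ q : X n, ∀ z, f z = q) :
    ∃ i, (p i).natDegree ≠ 0 := by
  by_contra! hcon
  refine h ⟨f 0, fun z => Subtype.ext ?_⟩
  obtain ⟨w, -, hw⟩ := (f z).2
  obtain ⟨w₀, -, hw₀⟩ := (f 0).2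
  have : w = w₀ := by
    funext i
    have h1 := hfp z i
    have h2 := hfp 0 i
    rw [Polynomial.eq_C_of_natDegree_eq_zero (hcon i), Polynomial.eval_C] at h1 h2
    rw [coords, hw, affine_mk] at h1
    rw [coords, hw₀, affine_mk] at h2
    rw [h1, h2]
  subst this
  rw [hw, hw₀]

end HolTorus

end

theorem mainTheorem3 (n : ℕ) (f : ℂ → HolTorus.X n) (hf : HolTorus.IsHolomorphic f) :
    (HolTorus.order f < ⊤ ↔ HolTorus.growthExponent f < ⊤) ∧
    ((¬ ∃ p : HolTorus.X n, ∀ z : ℂ, f z = p) →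
      HolTorus.order f < ⊤ → HolTorus.growthExponent f < ⊤ →
        ⊥ < HolTorus.order f ∧ ⊥ < HolTorus.growthExponent f ∧
        HolTorus.order f = HolTorus.growthExponent f + 1) := by
  refine ⟨⟨fun h => ?_, HolTorus.order_lt_top_of_growthExponent_lt_top hf⟩, fun hnc h _ => ?_⟩
  · obtain ⟨p, hfp⟩ := HolTorus.exists_polynomial_of_order_lt_top hf h
    -- The supremum of the degrees is a common bound even for `n = 0`.
    exact (HolTorus.growthExponent_le hf hfp fun i =>
      Finset.le_sup (f := fun i => (p i).natDegree) (Finset.mem_univ i)).trans_lt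
        (EReal.coe_lt_top _)
  · obtain ⟨p, hfp⟩ := HolTorus.exists_polynomial_of_order_lt_top hf h
    obtain ⟨i₀, hi₀⟩ := HolTorus.exists_natDegree_ne_zero hfp hnc
    have : Nonempty (Fin n) := ⟨i₀⟩
    obtain ⟨i₁, hi₁⟩ := Finite.exists_max fun i => (p i).natDegree
    have hk0 : (p i₁).natDegree ≠ 0 := fun h0 => hi₀ (Nat.le_zero.1 (h0 ▸ hi₁ i₀))
    have hlead : (p i₁).coeff (p i₁).natDegree ≠ 0 := fun h0 => hk0 (by
      rw [Polynomial.leadingCoeff_eq_zero.1 h0, Polynomial.natDegree_zero])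
    have hord := le_antisymm (HolTorus.order_le hf hfp hi₁) (HolTorus.le_order hf hfp hk0 hlead)
    have hgr := le_antisymm (HolTorus.growthExponent_le hf hfp hi₁)
      (HolTorus.le_growthExponent hf hfp hi₁ hk0 ⟨i₁, hlead⟩)
    rw [hord, hgr]
    refine ⟨EReal.bot_lt_coe _, EReal.bot_lt_coe _, ?_⟩
    -- Since `k ≥ 1`, the truncated difference `k - 1` is the true one.
    rw [Nat.cast_sub (Nat.one_le_iff_ne_zero.2 hk0), ← EReal.coe_one, ← EReal.coe_add]
    simp
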